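/- Let $R$ be a commutative ring with $1$ and let $(\mathcal X,\diamond,\mathbf 1)$ be an essentially small $R$-linear symmetric monoidal category (so $\diamond$ is $R$-bilinear on morphisms), with unit isomorphisms $\lambda_x:\mathbf 1\diamond x\to x$ and symmetry $s$. Let $\mathcal F$ be the category of $R$-linear functors $\mathcal X\to R\text{-Mod}$, which is monoidal under Day convolution $$(F\otimes G)(x)=\int^{y,z}\mathcal X(y\diamond z,x)\otimes_R F(y)\otimes_R G(z)$$ with unit $\mathcal X(\mathbf 1,-)$. Let $A$ be a monoid in $\mathcal F$. For an $A$-module (left module object) $M$, write $a\times m\in M(y\diamond z)$ for the product of $a\in A(y)$ and $m\in M(z)$ induced by the action $A\otimes M\to M$; in particular this applies to $M=A$. The commutant of $A$ at $\mathbf 1$ is $$CA(\mathbf 1)=\{b\in A(\mathbf 1)\mid a\times b=A(s_{\mathbf 1,y})(b\times a)\ \text{ for all } y\in\mathcal X,\ a\in A(y)\},$$ where $s_{\mathbf 1,y}:\mathbf 1\diamond y\to y\diamond\mathbf 1$. For $a\in CA(\mathbf 1)$ let $L_a:A\to A$ be the morphism of $A$-modules $b\mapsto A(\lambda_x)(a\times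 b)$ $(b\in A(x))$. Let $n\ge 1$ and $\alpha=(\alpha_1,\dots,\alpha_n)$ with $\alpha_i\in CA(\mathbf 1)$. Let $A\langle\alpha_1,\dots,\alpha_i\rangle$ be the $A$-submodule of $A$ generated by $\alpha_1,\dots,\alpha_i$ (the intersection of all $A$-submodules $N$ of $A$ with $\alpha_1,\dots,\alpha_i\in N(\mathbf 1)$; it is $0$ for $i=0$), and $A\langle\alpha\rangle=A\langle\alpha_1,\dots,\alpha_n\rangle$. The sequence $\alpha$ is called regular if 1. for every $1\le i\le n$, every object $x$ and every $0\ne m\in (A/A\langle\alpha_1,\dots,\alpha_{i-1}\rangle)(x)$, one has $\alpha_i\times m\neq 0$; and 2. $A/A\langle\alpha\rangle\neq 0$. For $p\ge 0$ let $K_p^n(A)=\bigoplus_{S\subseteq\{1,\dots,n\},\,|S|=p}A_S$ with $A_S=A$, so that $K_0^n(A)=A$, and for $p\geq 1$ let $d:K_p^n(A)\to K_{p-1}^n(A)$ be the morphism of $A$-modules whose restriction to the summand $A_S$ with $S=\{i_1<\dots<i_p\}$ is $\sum_{k=1}^p(-1)^{k+1}L_{\alpha_{i_k}}$, the $k$-th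 term taking values in the summand $A_{S\setminus\{i_k\}}$. For $p=1$ write $L_\alpha=d:K_1^n(A)\to A$. **Theorem.** If $\alpha$ is a regular sequence, then the Koszul complex $K_A(\alpha)=(K_\bullet^n(A),d)$ is a resolution of $A/A\langle\alpha\rangle$; that is, the sequence $$0\to K_n^n(A)\xrightarrow{d}\cdots\xrightarrow{d}K_2^n(A)\xrightarrow{d}K_1^n(A)\xrightarrow{L_\alpha}A\to A/A\langle\alpha\rangle\to 0$$ is an exact sequence of $A$-modules. -/

import Mathlib

open CategoryTheory MonoidalCategory

universe w u

/-- The objects of the category `𝓕`: the `R`-linear functors from `X` to `R`-modules. -/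
structure LinFun (R : Type w) [CommRing R] (X : Type u) [Category.{w} X] [Preadditive X]
    [Linear R X] where
  functor : X ⥤ ModuleCat.{w} R
  additive : functor.Additive
  linear : functor.Linear R

set_option linter.unusedSectionVars false

noncomputable section

namespace LinFun

section Basic

variable {R : Type w} [CommRing R] {X : Type u} [Category.{w} X] [Preadditive X] [Linear R X]

attribute [instance] LinFun.additive LinFun.linear

/-- Morphisms of `𝓕` are the natural transformations. -/
instance : Category (LinFun R X) :=
  inferInstanceAs (Category (InducedCategory _ LinFun.functor))

/-- The `R`-module `F(x)`. -/
abbrev El (F : LinFun R X) (x : X) : Type w := F.functor.obj x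

/-- The `R`-linear map `F(f) : F(x) → F(y)`. -/
def mp (F : LinFun R X) {x y : X} (f : x ⟶ y) : F.El x →ₗ[R] F.El y := (F.functor.map f).hom

/-- The component at `x` of a morphism of `𝓕`. -/
def ev {F G : LinFun R X} (η : F ⟶ G) (x : X) : F.El x →ₗ[R] G.El x := (η.hom.app x).hom

@[simp] lemma mp_id (F : LinFun R X) (x : X) (a : F.El x) : F.mp (𝟙 x) a = a := by
  simp [mp]

lemma mp_comp (F : LinFun R X) {x y z : X} (f : x ⟶ y) (g : y ⟶ z) (a : F.El x) :
    F.mp (f ≫ g) a = F.mp g (F.mp f a) := by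
  simp [mp]

lemma mp_congr (F : LinFun R X) {x y : X} {f g : x ⟶ y} (h : f = g) (a : F.El x) :
    F.mp f a = F.mp g a := by rw [h]

lemma mp_add (F : LinFun R X) {x y : X} (f g : x ⟶ y) (a : F.El x) :
    F.mp (f + g) a = F.mp f a + F.mp g a := by
  simp [mp, F.functor.map_add]

lemma mp_smul (F : LinFun R X) {x y : X} (r : R) (f : x ⟶ y) (a : F.El x) :
    F.mp (r • f) a = r • F.mp f a := by
  simp [mp, F.functor.map_smul]

lemma ev_mp {F G : LinFun R X} (η : F ⟶ G) {x y : X} (f : x ⟶ y) (a : F.El x) :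
    ev η y (F.mp f a) = G.mp f (ev η x a) :=
  LinearMap.congr_fun (congrArg ModuleCat.Hom.hom (η.hom.naturality f)) a

@[simp] lemma ev_id (F : LinFun R X) (x : X) (a : F.El x) : ev (𝟙 F) x a = a := rfl

@[simp] lemma ev_comp {F G H : LinFun R X} (η : F ⟶ G) (θ : G ⟶ H) (x : X) (a : F.El x) :
    ev (η ≫ θ) x a = ev θ x (ev η x a) := rfl

lemma hom_ext {F G : LinFun R X} {η θ : F ⟶ G} (h : ∀ x a, ev η x a = ev θ x a) : η = θ := by
  apply InducedCategory.hom_ext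
  ext x a
  exact h x a

/-- Build a linear functor from its modules of values and its maps. -/
def ofData (M : X → Type w) [∀ x, AddCommGroup (M x)] [∀ x, Module R (M x)]
    (m : ∀ {x y : X}, (x ⟶ y) → M x →ₗ[R] M y)
    (hid : ∀ x a, m (𝟙 x) a = a)
    (hcomp : ∀ {x y z : X} (f : x ⟶ y) (g : y ⟶ z) (a : M x), m (f ≫ g) a = m g (m f a))
    (hadd : ∀ {x y : X} (f g : x ⟶ y) (a : M x), m (f + g) a = m f a + m g a)
    (hsmul : ∀ {x y : X} (r : R) (f : x ⟶ y) (a : M x), m (r • f) a = r • m f a) :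
    LinFun R X where
  functor :=
    { obj := fun x => ModuleCat.of R (M x)
      map := fun f => ModuleCat.ofHom (m f)
      map_id := fun x => by ext a; exact hid x a
      map_comp := fun f g => by ext a; exact hcomp f g a }
  additive := ⟨fun {x y f g} => by ext a; exact hadd f g a⟩
  linear := ⟨fun {x y} f r => by ext a; exact hsmul r f a⟩

/-- Build a morphism of `𝓕` from its components. -/
def homMk {F G : LinFun R X} (η : ∀ x, F.El x →ₗ[R] G.El x)
    (h : ∀ {x y : X} (f : x ⟶ y) (a : F.El x), η y (F.mp f a) = G.mp f (η x a)) : F ⟶ G :=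
  InducedCategory.homMk
    { app := fun x => ModuleCat.ofHom (η x)
      naturality := fun x y f => by ext a; exact h f a }

@[simp] lemma ev_homMk {F G : LinFun R X} (η : ∀ x, F.El x →ₗ[R] G.El x)
    (h : ∀ {x y : X} (f : x ⟶ y) (a : F.El x), η y (F.mp f a) = G.mp f (η x a)) (x : X) :
    ev (homMk η h) x = η x := rfl

end Basic

/-! ### The tensor product of `𝓕` (Day convolution)

`(F ⊗ G)(x)` is the coend of `X(y ⊗ z, x) ⊗ F(y) ⊗ G(z)` over `y, z`, presented by generators
`(φ, a, b)` with `φ : y ⊗ z ⟶ x`, `a ∈ F(y)`, `b ∈ G(z)` and relations saying that they are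
`R`-trilinear and dinatural in `y` and `z`. -/

section Day

variable {R : Type w} [CommRing R] {X : Type u} [Category.{w} X] [Preadditive X] [Linear R X]
  [MonoidalCategory X]

/-- Generators of `(F ⊗ G)(x)`. -/
structure DayGen (F G : LinFun R X) (x : X) where
  {y z : X}
  φ : y ⊗ z ⟶ x
  a : F.El y
  b : G.El z

/-- Free generators, as elements of the free module. -/
abbrev DayGen.free {F G : LinFun R X} {x y z : X} (φ : y ⊗ z ⟶ x) (a : F.El y) (b : G.El z) :
    DayGen F G x →₀ R := Finsupp.single ⟨φ, a, b⟩ 1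

/-- The relators of `(F ⊗ G)(x)`. -/
inductive DayRel (F G : LinFun R X) (x : X) : (DayGen F G x →₀ R) → Prop
  | hom_add {y z : X} (φ ψ : y ⊗ z ⟶ x) (a : F.El y) (b : G.El z) :
      DayRel F G x (DayGen.free (φ + ψ) a b - (DayGen.free φ a b + DayGen.free ψ a b))
  | hom_smul {y z : X} (r : R) (φ : y ⊗ z ⟶ x) (a : F.El y) (b : G.El z) :
      DayRel F G x (DayGen.free (r • φ) a b - r • DayGen.free φ a b)
  | left_add {y z : X} (φ : y ⊗ z ⟶ x) (a a' : F.El y) (b : G.El z) :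
      DayRel F G x (DayGen.free φ (a + a') b - (DayGen.free φ a b + DayGen.free φ a' b))
  | left_smul {y z : X} (r : R) (φ : y ⊗ z ⟶ x) (a : F.El y) (b : G.El z) :
      DayRel F G x (DayGen.free φ (r • a) b - r • DayGen.free φ a b)
  | right_add {y z : X} (φ : y ⊗ z ⟶ x) (a : F.El y) (b b' : G.El z) :
      DayRel F G x (DayGen.free φ a (b + b') - (DayGen.free φ a b + DayGen.free φ a b'))
  | right_smul {y z : X} (r : R) (φ : y ⊗ z ⟶ x) (a : F.El y) (b : G.El z) :
      DayRel F G x (DayGen.free φ a (r • b) - r • DayGen.free φ a b)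
  | dinat {y z y' z' : X} (f : y ⟶ y') (g : z ⟶ z') (φ : y' ⊗ z' ⟶ x) (a : F.El y)
      (b : G.El z) :
      DayRel F G x (DayGen.free φ (F.mp f a) (G.mp g b) - DayGen.free ((f ⊗ₘ g) ≫ φ) a b)

/-- The coend, in a possibly larger universe. -/
abbrev DayPre (F G : LinFun R X) (x : X) : Type (max u w) :=
  (DayGen F G x →₀ R) ⧸ Submodule.span R {r | DayRel F G x r}

lemma DayPre.rel {F G : LinFun R X} {x : X} {s t : DayGen F G x →₀ R} (h : DayRel F G x (s - t)) :
    (Submodule.Quotient.mk s : DayPre F G x) = Submodule.Quotient.mk t :=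
  (Submodule.Quotient.eq _).2 (Submodule.subset_span h)

variable [EssentiallySmall.{w} X]

instance (F G : LinFun R X) (x : X) : Small.{w} (DayPre F G x) := by
  let e := (equivSmallModel.{w} X).inverse
  let c := (equivSmallModel.{w} X).functor
  let J : Type w := Σ (y z : SmallModel.{w} X), (e.obj y ⊗ e.obj z ⟶ x) × F.El (e.obj y) ×
    G.El (e.obj z)
  let k : J → DayGen F G x := fun j => ⟨j.2.2.1, j.2.2.2.1, j.2.2.2.2⟩
  let q : (J →₀ R) →ₗ[R] DayPre F G x :=
    (Submodule.mkQ _).comp (Finsupp.lmapDomain R R k)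
  have hq : Function.Surjective q := by
    rw [← LinearMap.range_eq_top, eq_top_iff]
    rintro t -
    obtain ⟨t, rfl⟩ := Submodule.Quotient.mk_surjective _ t
    induction t using Finsupp.induction_linear with
    | zero => exact Submodule.zero_mem _
    | add s t hs ht => exact Submodule.add_mem _ hs ht
    | single g r =>
      obtain ⟨φ, a, b⟩ := g
      rename_i y z
      rw [show (Finsupp.single (⟨φ, a, b⟩ : DayGen F G x) r) = r • DayGen.free φ a b by simp]
      rw [Submodule.Quotient.mk_smul]
      refine Submodule.smul_mem (LinearMap.range q) r ?_
      let i : ∀ v : X, v ≅ e.obj (c.obj v) := fun v => (equivSmallModel.{w} X).unitIso.app v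
      refine ⟨Finsupp.single ⟨c.obj y, c.obj z, ((i y).inv ⊗ₘ (i z).inv) ≫ φ,
        F.mp (i y).hom a, G.mp (i z).hom b⟩ 1, ?_⟩
      have h := DayPre.rel (DayRel.dinat (i y).hom (i z).hom (((i y).inv ⊗ₘ (i z).inv) ≫ φ) a b)
      rw [← Category.assoc, tensorHom_comp_tensorHom] at h
      simp only [Iso.hom_inv_id, id_tensorHom_id, Category.id_comp] at h
      rw [← h]
      simp [q, k]
  exact small_of_surjective hq

/-- The module `(F ⊗ G)(x)`. -/
def DayEl (F G : LinFun R X) (x : X) : Type w := Shrink.{w} (DayPre F G x)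

instance (F G : LinFun R X) (x : X) : AddCommGroup (DayEl F G x) :=
  inferInstanceAs (AddCommGroup (Shrink.{w} (DayPre F G x)))

instance (F G : LinFun R X) (x : X) : Module R (DayEl F G x) :=
  inferInstanceAs (Module R (Shrink.{w} (DayPre F G x)))

/-- The two universe sizes of the coend are isomorphic modules. -/
def dayElEquiv (F G : LinFun R X) (x : X) : DayEl F G x ≃ₗ[R] DayPre F G x :=
  Shrink.linearEquiv R (DayPre F G x)

/-- The class of the generator `(φ, a, b)` in `(F ⊗ G)(x)`. -/
def dmk {F G : LinFun R X} {x y z : X} (φ : y ⊗ z ⟶ x) (a : F.El y) (b : G.El z) : DayEl F G x :=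
  (dayElEquiv F G x).symm (Submodule.Quotient.mk (DayGen.free φ a b))

section

variable {F G : LinFun R X} {x y z : X}

lemma dmk_hom_add (φ ψ : y ⊗ z ⟶ x) (a : F.El y) (b : G.El z) :
    dmk (φ + ψ) a b = dmk φ a b + dmk ψ a b := by
  simp only [dmk]
  rw [DayPre.rel (DayRel.hom_add φ ψ a b), Submodule.Quotient.mk_add, map_add]

lemma dmk_hom_smul (r : R) (φ : y ⊗ z ⟶ x) (a : F.El y) (b : G.El z) :
    dmk (r • φ) a b = r • dmk φ a b := by
  simp only [dmk]
  rw [DayPre.rel (DayRel.hom_smul r φ a b), Submodule.Quotient.mk_smul, map_smul]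

lemma dmk_left_add (φ : y ⊗ z ⟶ x) (a a' : F.El y) (b : G.El z) :
    dmk φ (a + a') b = dmk φ a b + dmk φ a' b := by
  simp only [dmk]
  rw [DayPre.rel (DayRel.left_add φ a a' b), Submodule.Quotient.mk_add, map_add]

lemma dmk_left_smul (r : R) (φ : y ⊗ z ⟶ x) (a : F.El y) (b : G.El z) :
    dmk φ (r • a) b = r • dmk φ a b := by
  simp only [dmk]
  rw [DayPre.rel (DayRel.left_smul r φ a b), Submodule.Quotient.mk_smul, map_smul]

lemma dmk_right_add (φ : y ⊗ z ⟶ x) (a : F.El y) (b b' : G.El z) :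
    dmk φ a (b + b') = dmk φ a b + dmk φ a b' := by
  simp only [dmk]
  rw [DayPre.rel (DayRel.right_add φ a b b'), Submodule.Quotient.mk_add, map_add]

lemma dmk_right_smul (r : R) (φ : y ⊗ z ⟶ x) (a : F.El y) (b : G.El z) :
    dmk φ a (r • b) = r • dmk φ a b := by
  simp only [dmk]
  rw [DayPre.rel (DayRel.right_smul r φ a b), Submodule.Quotient.mk_smul, map_smul]

lemma dmk_dinat {y' z' : X} (f : y ⟶ y') (g : z ⟶ z') (φ : y' ⊗ z' ⟶ x) (a : F.El y)
    (b : G.El z) : dmk φ (F.mp f a) (G.mp g b) = dmk ((f ⊗ₘ g) ≫ φ) a b := by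
  simp only [dmk]
  rw [DayPre.rel (DayRel.dinat f g φ a b)]

lemma dayEl_ext {N : Type*} [AddCommGroup N] [Module R N] {p q : DayEl F G x →ₗ[R] N}
    (h : ∀ (y z : X) (φ : y ⊗ z ⟶ x) (a : F.El y) (b : G.El z), p (dmk φ a b) = q (dmk φ a b)) :
    p = q := by
  have : p.comp (dayElEquiv F G x).symm.toLinearMap =
      q.comp (dayElEquiv F G x).symm.toLinearMap := by
    apply Submodule.linearMap_qext
    apply Finsupp.lhom_ext'
    rintro ⟨φ, a, b⟩
    ext
    exact h _ _ φ a b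
  ext t
  obtain ⟨t, rfl⟩ := (dayElEquiv F G x).symm.surjective t
  exact LinearMap.congr_fun this t

/-- Linear maps out of `(F ⊗ G)(x)`. -/
def dayElLift {N : Type*} [AddCommGroup N] [Module R N]
    (p : ∀ (y z : X), (y ⊗ z ⟶ x) → F.El y → G.El z → N)
    (hom_add : ∀ y z φ ψ a b, p y z (φ + ψ) a b = p y z φ a b + p y z ψ a b)
    (hom_smul : ∀ y z (r : R) φ a b, p y z (r • φ) a b = r • p y z φ a b)
    (left_add : ∀ y z φ a a' b, p y z φ (a + a') b = p y z φ a b + p y z φ a' b)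
    (left_smul : ∀ y z (r : R) φ a b, p y z φ (r • a) b = r • p y z φ a b)
    (right_add : ∀ y z φ a b b', p y z φ a (b + b') = p y z φ a b + p y z φ a b')
    (right_smul : ∀ y z (r : R) φ a b, p y z φ a (r • b) = r • p y z φ a b)
    (dinat : ∀ y z y' z' (f : y ⟶ y') (g : z ⟶ z') φ a b,
      p y' z' φ (F.mp f a) (G.mp g b) = p y z ((f ⊗ₘ g) ≫ φ) a b) :
    DayEl F G x →ₗ[R] N :=
  (Submodule.liftQ _ (Finsupp.lift N R (DayGen F G x) (fun g => p g.y g.z g.φ g.a g.b)) (by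
    rw [Submodule.span_le]
    rintro r hr
    have hs : ∀ {y z : X} (φ : y ⊗ z ⟶ x) (a : F.El y) (b : G.El z),
        Finsupp.lift N R (DayGen F G x) (fun g => p g.y g.z g.φ g.a g.b) (DayGen.free φ a b) =
          p y z φ a b := by
      intro y z φ a b
      simp
    rw [SetLike.mem_coe, LinearMap.mem_ker]
    cases hr with
    | hom_add φ ψ a b => simp only [map_sub, map_add, hs, hom_add, sub_self]
    | hom_smul r φ a b => simp only [map_sub, map_smul, hs, hom_smul, sub_self]
    | left_add φ a a' b => simp only [map_sub, map_add, hs, left_add, sub_self]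
    | left_smul r φ a b => simp only [map_sub, map_smul, hs, left_smul, sub_self]
    | right_add φ a b b' => simp only [map_sub, map_add, hs, right_add, sub_self]
    | right_smul r φ a b => simp only [map_sub, map_smul, hs, right_smul, sub_self]
    | dinat f g φ a b => simp only [map_sub, hs, dinat, sub_self])).comp
    (dayElEquiv F G x).toLinearMap

@[simp] lemma dayElLift_dmk {N : Type*} [AddCommGroup N] [Module R N]
    (p : ∀ (y z : X), (y ⊗ z ⟶ x) → F.El y → G.El z → N) (h₁ h₂ h₃ h₄ h₅ h₆ h₇)
    (y z : X) (φ : y ⊗ z ⟶ x) (a : F.El y) (b : G.El z) :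
    dayElLift p h₁ h₂ h₃ h₄ h₅ h₆ h₇ (dmk φ a b) = p y z φ a b := by
  simp [dayElLift, dmk]

end

/-- The functoriality of `(F ⊗ G)(x)` in `x`: it sends `(φ, a, b)` to `(φ ≫ h, a, b)`. -/
def dayMap (F G : LinFun R X) {x x' : X} (h : x ⟶ x') : DayEl F G x →ₗ[R] DayEl F G x' :=
  dayElLift (fun _ _ φ a b => dmk (φ ≫ h) a b)
    (by intros; rw [Preadditive.add_comp, dmk_hom_add])
    (by intros; rw [Linear.smul_comp, dmk_hom_smul])
    (by intros; rw [dmk_left_add]) (by intros; rw [dmk_left_smul])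
    (by intros; rw [dmk_right_add]) (by intros; rw [dmk_right_smul])
    (by intros; rw [dmk_dinat, Category.assoc])

@[simp] lemma dayMap_dmk {F G : LinFun R X} {x x' y z : X} (h : x ⟶ x') (φ : y ⊗ z ⟶ x)
    (a : F.El y) (b : G.El z) : dayMap F G h (dmk φ a b) = dmk (φ ≫ h) a b :=
  dayElLift_dmk _ _ _ _ _ _ _ _ _ _ _ _ _

/-- The functor `F ⊗ G`. -/
def day (F G : LinFun R X) : LinFun R X :=
  ofData (DayEl F G) (fun h => dayMap F G h)
    (fun x => LinearMap.congr_fun (f := dayMap F G (𝟙 x)) (g := LinearMap.id)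
      (dayEl_ext (by intros; simp)))
    (fun f g => LinearMap.congr_fun (f := dayMap F G (f ≫ g))
      (g := (dayMap F G g).comp (dayMap F G f)) (dayEl_ext (by intros; simp)))
    (fun f g => LinearMap.congr_fun (f := dayMap F G (f + g)) (g := dayMap F G f + dayMap F G g)
      (dayEl_ext (by intros; simp [Preadditive.comp_add, dmk_hom_add])))
    (fun r f => LinearMap.congr_fun (f := dayMap F G (r • f)) (g := r • dayMap F G f)
      (dayEl_ext (by intros; simp [Linear.comp_smul, dmk_hom_smul])))

/-- The universal pairing `F(y) × G(z) → (F ⊗ G)(y ⊗ z)`. -/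
def pr {F G : LinFun R X} {y z : X} (a : F.El y) (b : G.El z) : (day F G).El (y ⊗ z) :=
  dmk (𝟙 (y ⊗ z)) a b

section

variable {F G H : LinFun R X}

lemma mp_pr {x y z : X} (φ : y ⊗ z ⟶ x) (a : F.El y) (b : G.El z) :
    (day F G).mp φ (pr a b) = dmk φ a b := by
  have : dayMap F G φ (dmk (𝟙 (y ⊗ z)) a b) = dmk φ a b := by simp
  exact this

lemma pr_mp {y z y' z' : X} (f : y ⟶ y') (g : z ⟶ z') (a : F.El y) (b : G.El z) :
    (pr (F.mp f a) (G.mp g b) : (day F G).El _) = (day F G).mp (f ⊗ₘ g) (pr a b) := by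
  rw [mp_pr, pr, dmk_dinat, Category.comp_id]

lemma pr_mp_left {y z y' : X} (f : y ⟶ y') (a : F.El y) (b : G.El z) :
    (pr (F.mp f a) b : (day F G).El _) = (day F G).mp (f ▷ z) (pr a b) := by
  have := pr_mp f (𝟙 z) a b
  rwa [mp_id, tensorHom_id] at this

lemma pr_mp_right {y z z' : X} (g : z ⟶ z') (a : F.El y) (b : G.El z) :
    (pr a (G.mp g b) : (day F G).El _) = (day F G).mp (y ◁ g) (pr a b) := by
  have := pr_mp (𝟙 y) g a b
  rwa [mp_id, id_tensorHom] at this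

lemma pr_add_left {y z : X} (a a' : F.El y) (b : G.El z) :
    (pr (a + a') b : (day F G).El _) = pr a b + pr a' b := dmk_left_add _ _ _ _

lemma pr_smul_left {y z : X} (r : R) (a : F.El y) (b : G.El z) :
    (pr (r • a) b : (day F G).El _) = r • pr a b := dmk_left_smul _ _ _ _

lemma pr_add_right {y z : X} (a : F.El y) (b b' : G.El z) :
    (pr a (b + b') : (day F G).El _) = pr a b + pr a b' := dmk_right_add _ _ _ _

lemma pr_smul_right {y z : X} (r : R) (a : F.El y) (b : G.El z) :
    (pr a (r • b) : (day F G).El _) = r • pr a b := dmk_right_smul _ _ _ _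

lemma day_hom_ext {η θ : day F G ⟶ H}
    (h : ∀ (y z : X) (a : F.El y) (b : G.El z), ev η _ (pr a b) = ev θ _ (pr a b)) : η = θ := by
  apply hom_ext
  intro x
  refine LinearMap.congr_fun (dayEl_ext ?_)
  intro y z φ a b
  rw [← mp_pr]
  erw [ev_mp, ev_mp, h]

/-- The component at `x` of `dayLift` below: it sends `(φ, a, b)` to `H(φ)(p(a, b))`. -/
def dayLiftEl (p : ∀ (y z : X), F.El y → G.El z → H.El (y ⊗ z))
    (left_add : ∀ y z a a' b, p y z (a + a') b = p y z a b + p y z a' b)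
    (left_smul : ∀ y z (r : R) a b, p y z (r • a) b = r • p y z a b)
    (right_add : ∀ y z a b b', p y z a (b + b') = p y z a b + p y z a b')
    (right_smul : ∀ y z (r : R) a b, p y z a (r • b) = r • p y z a b)
    (nat : ∀ y z y' z' (f : y ⟶ y') (g : z ⟶ z') a b,
      p y' z' (F.mp f a) (G.mp g b) = H.mp (f ⊗ₘ g) (p y z a b)) (x : X) :
    DayEl F G x →ₗ[R] H.El x :=
  dayElLift (fun y z φ a b => H.mp φ (p y z a b))
    (by intros; rw [mp_add]) (by intros; rw [mp_smul])
    (by intros; rw [left_add, map_add]) (by intros; rw [left_smul, map_smul])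
    (by intros; rw [right_add, map_add]) (by intros; rw [right_smul, map_smul])
    (by intros; rw [nat, mp_comp])

@[simp] lemma dayLiftEl_dmk (p : ∀ (y z : X), F.El y → G.El z → H.El (y ⊗ z)) (h₁ h₂ h₃ h₄ h₅)
    (x y z : X) (φ : y ⊗ z ⟶ x) (a : F.El y) (b : G.El z) :
    dayLiftEl p h₁ h₂ h₃ h₄ h₅ x (dmk φ a b) = H.mp φ (p y z a b) := by
  simp [dayLiftEl]

/-- The universal property: natural bilinear pairings `F(y) × G(z) → H(y ⊗ z)` give morphisms
`F ⊗ G ⟶ H`. -/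
def dayLift (p : ∀ (y z : X), F.El y → G.El z → H.El (y ⊗ z))
    (left_add : ∀ y z a a' b, p y z (a + a') b = p y z a b + p y z a' b)
    (left_smul : ∀ y z (r : R) a b, p y z (r • a) b = r • p y z a b)
    (right_add : ∀ y z a b b', p y z a (b + b') = p y z a b + p y z a b')
    (right_smul : ∀ y z (r : R) a b, p y z a (r • b) = r • p y z a b)
    (nat : ∀ y z y' z' (f : y ⟶ y') (g : z ⟶ z') a b,
      p y' z' (F.mp f a) (G.mp g b) = H.mp (f ⊗ₘ g) (p y z a b)) : day F G ⟶ H :=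
  homMk (dayLiftEl p left_add left_smul right_add right_smul nat)
    (fun {x x'} f => LinearMap.congr_fun
      (f := (dayLiftEl p left_add left_smul right_add right_smul nat x').comp (dayMap F G f))
      (g := (H.mp f).comp (dayLiftEl p left_add left_smul right_add right_smul nat x))
      (dayEl_ext (by
        intro y z φ a b
        simp [mp_comp])))

@[simp] lemma dayLift_pr (p : ∀ (y z : X), F.El y → G.El z → H.El (y ⊗ z)) (h₁ h₂ h₃ h₄ h₅)
    (y z : X) (a : F.El y) (b : G.El z) :
    ev (dayLift p h₁ h₂ h₃ h₄ h₅) (y ⊗ z) (pr a b) = p y z a b := by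
  have : dayLiftEl p h₁ h₂ h₃ h₄ h₅ (y ⊗ z) (dmk (𝟙 (y ⊗ z)) a b) = p y z a b := by simp
  exact this

end

lemma day_induction {F G : LinFun R X} {x : X} {P : (day F G).El x → Prop} (zero : P 0)
    (add : ∀ s t, P s → P t → P (s + t))
    (pure : ∀ (y z : X) (φ : y ⊗ z ⟶ x) (a : F.El y) (b : G.El z), P ((day F G).mp φ (pr a b)))
    (t : (day F G).El x) : P t := by
  obtain ⟨t, rfl⟩ := (dayElEquiv F G x).symm.surjective t
  obtain ⟨t, rfl⟩ := Submodule.Quotient.mk_surjective _ t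
  induction t using Finsupp.induction_linear with
  | zero => rw [Submodule.Quotient.mk_zero, map_zero]; exact zero
  | add s t hs ht =>
    rw [Submodule.Quotient.mk_add, map_add]
    exact add _ _ hs ht
  | single g r =>
    obtain ⟨φ, a, b⟩ := g
    have h := pure _ _ φ (r • a) b
    rw [mp_pr, dmk_left_smul] at h
    rw [show (Finsupp.single (⟨φ, a, b⟩ : DayGen F G x) r) = r • DayGen.free φ a b by simp,
      Submodule.Quotient.mk_smul, map_smul]
    exact h

/-- The universal pairing as a bilinear map. -/
def prLin (F G : LinFun R X) (y z : X) : F.El y →ₗ[R] G.El z →ₗ[R] (day F G).El (y ⊗ z) :=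
  LinearMap.mk₂ R pr pr_add_left pr_smul_left pr_add_right pr_smul_right

lemma pr_zero_left {F G : LinFun R X} {y z : X} (b : G.El z) :
    (pr (0 : F.El y) b : (day F G).El _) = 0 := (prLin F G y z).map_zero₂ b

lemma pr_zero_right {F G : LinFun R X} {y z : X} (a : F.El y) :
    (pr a (0 : G.El z) : (day F G).El _) = 0 := (prLin F G y z a).map_zero

section Structure

/-- The action of the tensor product on morphisms. -/
def dayHom {F F' G G' : LinFun R X} (η : F ⟶ F') (θ : G ⟶ G') : day F G ⟶ day F' G' :=
  dayLift (fun y z a b => pr (ev η y a) (ev θ z b))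
    (by intros; rw [map_add, pr_add_left]) (by intros; rw [map_smul, pr_smul_left])
    (by intros; rw [map_add, pr_add_right]) (by intros; rw [map_smul, pr_smul_right])
    (by intros; rw [ev_mp, ev_mp, pr_mp])

@[simp] lemma dayHom_pr {F F' G G' : LinFun R X} (η : F ⟶ F') (θ : G ⟶ G') {y z : X}
    (a : F.El y) (b : G.El z) :
    ev (dayHom η θ) (y ⊗ z) (pr a b) = pr (ev η y a) (ev θ z b) :=
  dayLift_pr _ _ _ _ _ _ _ _ _ _

variable [MonoidalPreadditive X] [MonoidalLinear R X]

/-- The functor `x ↦ H(x ⊗ z)`. -/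
def shiftRight (H : LinFun R X) (z : X) : LinFun R X :=
  ofData (fun x => H.El (x ⊗ z)) (fun f => H.mp (f ▷ z))
    (by intros; rw [id_whiskerRight, mp_id])
    (by intros; rw [comp_whiskerRight, mp_comp])
    (by intros; rw [MonoidalPreadditive.add_whiskerRight, mp_add])
    (by intros; rw [MonoidalLinear.smul_whiskerRight, mp_smul])

/-- The functor `x ↦ H(y ⊗ x)`. -/
def shiftLeft (H : LinFun R X) (y : X) : LinFun R X :=
  ofData (fun x => H.El (y ⊗ x)) (fun f => H.mp (y ◁ f))
    (by intros; rw [whiskerLeft_id, mp_id])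
    (by intros; rw [whiskerLeft_comp, mp_comp])
    (by intros; rw [MonoidalPreadditive.whiskerLeft_add, mp_add])
    (by intros; rw [MonoidalLinear.whiskerLeft_smul, mp_smul])

/-- For `c ∈ H(z)`, the map `a ⊗ b ↦ a ⊗ (b ⊗ c)`. -/
def assocHomAux (F G : LinFun R X) {H : LinFun R X} {z : X} (c : H.El z) :
    day F G ⟶ shiftRight (day F (day G H)) z :=
  dayLift (H := shiftRight (day F (day G H)) z)
    (fun y₁ y₂ a b => (day F (day G H)).mp (α_ y₁ y₂ z).inv (pr a (pr b c)))
    (by intros; rw [pr_add_left, map_add]; rfl) (by intros; rw [pr_smul_left, map_smul]; rfl)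
    (by intros; rw [pr_add_left, pr_add_right, map_add]; rfl)
    (by intros; rw [pr_smul_left, pr_smul_right, map_smul]; rfl)
    (by
      intro y₁ y₂ y₁' y₂' f g a b
      change _ = (day F (day G H)).mp ((f ⊗ₘ g) ▷ z) _
      rw [pr_mp_left (F := G) (G := H), pr_mp, ← mp_comp, ← mp_comp]
      refine mp_congr _ ?_ _
      simp [MonoidalCategory.tensorHom_def])

lemma assocHomAux_pr (F G : LinFun R X) {H : LinFun R X} {z y₁ y₂ : X} (c : H.El z)
    (a : F.El y₁) (b : G.El y₂) :
    ev (assocHomAux F G c) _ (pr a b) =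
      (day F (day G H)).mp (α_ y₁ y₂ z).inv (pr a (pr b c)) :=
  dayLift_pr _ _ _ _ _ _ _ _ _ _

/-- For `a ∈ F(y)`, the map `b ⊗ c ↦ (a ⊗ b) ⊗ c`. -/
def assocInvAux {F : LinFun R X} (G H : LinFun R X) {y : X} (a : F.El y) :
    day G H ⟶ shiftLeft (day (day F G) H) y :=
  dayLift (H := shiftLeft (day (day F G) H) y)
    (fun z₁ z₂ b c => (day (day F G) H).mp (α_ y z₁ z₂).hom (pr (pr a b) c))
    (by intros; rw [pr_add_right, pr_add_left, map_add]; rfl)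
    (by intros; rw [pr_smul_right, pr_smul_left, map_smul]; rfl)
    (by intros; rw [pr_add_right, map_add]; rfl)
    (by intros; rw [pr_smul_right, map_smul]; rfl)
    (by
      intro y₁ y₂ y₁' y₂' f g b c
      change _ = (day (day F G) H).mp (y ◁ (f ⊗ₘ g)) _
      rw [pr_mp_right (F := F) (G := G), pr_mp, ← mp_comp, ← mp_comp]
      refine mp_congr _ ?_ _
      simp [MonoidalCategory.tensorHom_def])

lemma assocInvAux_pr {F : LinFun R X} (G H : LinFun R X) {y z₁ z₂ : X} (a : F.El y)
    (b : G.El z₁) (c : H.El z₂) :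
    ev (assocInvAux G H a) _ (pr b c) =
      (day (day F G) H).mp (α_ y z₁ z₂).hom (pr (pr a b) c) :=
  dayLift_pr _ _ _ _ _ _ _ _ _ _

/-- The associator. -/
def assocHom (F G H : LinFun R X) : day (day F G) H ⟶ day F (day G H) :=
  dayLift (fun y z t c => ev (assocHomAux F G c) y t)
    (by intros; rw [map_add]; rfl) (by intros; rw [map_smul]; rfl)
    (by
      intro y z t c c'
      induction t using day_induction with
      | zero => simp only [map_zero]; exact (add_zero _).symm
      | add s t hs ht => simp only [map_add, hs, ht]; exact add_add_add_comm _ _ _ _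
      | pure y₁ y₂ φ a b =>
        simp only [ev_mp, assocHomAux_pr]
        rw [pr_add_right, pr_add_right, map_add]
        exact map_add ((shiftRight (day F (day G H)) z).mp φ) _ _)
    (by
      intro y z r t c
      induction t using day_induction with
      | zero => simp only [map_zero]; change _ = r • (0 : (day F (day G H)).El _); rw [smul_zero]; rfl
      | add s t hs ht => simp only [map_add, hs, ht]; exact (smul_add _ _ _).symm
      | pure y₁ y₂ φ a b =>
        simp only [ev_mp, assocHomAux_pr]
        rw [pr_smul_right, pr_smul_right, map_smul]
        exact map_smul ((shiftRight (day F (day G H)) z).mp φ) _ _)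
    (by
      intro y z y' z' f g t c
      induction t using day_induction with
      | zero => simp only [map_zero]; exact (map_zero _).symm
      | add s t hs ht => simp only [map_add, hs, ht]; exact (map_add _ _ _).symm
      | pure y₁ y₂ φ a b =>
        simp only [ev_mp, assocHomAux_pr]
        change (day F (day G H)).mp (f ▷ z') ((day F (day G H)).mp (φ ▷ z') _) =
          (day F (day G H)).mp (f ⊗ₘ g) ((day F (day G H)).mp (φ ▷ z) _)
        rw [pr_mp_right, pr_mp_right]
        simp only [← mp_comp]
        refine mp_congr _ ?_ _
        simp only [Category.assoc]
        rw [MonoidalCategory.tensorHom_def, ← whisker_exchange, ← whisker_exchange_assoc]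
        simp)

/-- The inverse of the associator. -/
def assocInv (F G H : LinFun R X) : day F (day G H) ⟶ day (day F G) H :=
  dayLift (fun y z a t => ev (assocInvAux G H a) z t)
    (by
      intro y z a a' t
      induction t using day_induction with
      | zero => simp only [map_zero]; exact (add_zero _).symm
      | add s t hs ht => simp only [map_add, hs, ht]; exact add_add_add_comm _ _ _ _
      | pure y₁ y₂ φ b c =>
        simp only [ev_mp, assocInvAux_pr]
        rw [pr_add_left, pr_add_left, map_add]
        exact map_add ((shiftLeft (day (day F G) H) y).mp φ) _ _)
    (by
      intro y z r a t
      induction t using day_induction with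
      | zero => simp only [map_zero]; change _ = r • (0 : (day (day F G) H).El _); rw [smul_zero]; rfl
      | add s t hs ht => simp only [map_add, hs, ht]; exact (smul_add _ _ _).symm
      | pure y₁ y₂ φ b c =>
        simp only [ev_mp, assocInvAux_pr]
        rw [pr_smul_left, pr_smul_left, map_smul]
        exact map_smul ((shiftLeft (day (day F G) H) y).mp φ) _ _)
    (by intros; rw [map_add]; rfl) (by intros; rw [map_smul]; rfl)
    (by
      intro y z y' z' f g a t
      induction t using day_induction with
      | zero => simp only [map_zero]; exact (map_zero _).symm
      | add s t hs ht => simp only [map_add, hs, ht]; exact (map_add _ _ _).symm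
      | pure y₁ y₂ φ b c =>
        simp only [ev_mp, assocInvAux_pr]
        change (day (day F G) H).mp (y' ◁ g) ((day (day F G) H).mp (y' ◁ φ) _) =
          (day (day F G) H).mp (f ⊗ₘ g) ((day (day F G) H).mp (y ◁ φ) _)
        rw [pr_mp_left, pr_mp_left]
        simp only [← mp_comp]
        refine mp_congr _ ?_ _
        simp only [Category.assoc]
        rw [MonoidalCategory.tensorHom_def', whisker_exchange, whisker_exchange_assoc]
        simp)

@[simp] lemma assocHom_pr (F G H : LinFun R X) {x y z : X} (a : F.El x) (b : G.El y)
    (c : H.El z) :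
    ev (assocHom F G H) _ (pr (pr a b) c) =
      (day F (day G H)).mp (α_ x y z).inv (pr a (pr b c)) := by
  have : ev (assocHom F G H) _ (pr (pr a b) c) = ev (assocHomAux F G c) _ (pr a b) :=
    dayLift_pr _ _ _ _ _ _ _ _ _ _
  rw [this, assocHomAux_pr]

@[simp] lemma assocInv_pr (F G H : LinFun R X) {x y z : X} (a : F.El x) (b : G.El y)
    (c : H.El z) :
    ev (assocInv F G H) _ (pr a (pr b c)) =
      (day (day F G) H).mp (α_ x y z).hom (pr (pr a b) c) := by
  have : ev (assocInv F G H) _ (pr a (pr b c)) = ev (assocInvAux G H a) _ (pr b c) :=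
    dayLift_pr _ _ _ _ _ _ _ _ _ _
  rw [this, assocInvAux_pr]

lemma day_hom_ext_left {F G H K : LinFun R X} {η θ : day (day F G) H ⟶ K}
    (h : ∀ (x y z : X) (a : F.El x) (b : G.El y) (c : H.El z),
      ev η _ (pr (pr a b) c) = ev θ _ (pr (pr a b) c)) : η = θ := by
  apply day_hom_ext
  intro y z t c
  induction t using day_induction with
  | zero => simp only [pr_zero_left, map_zero]
  | add s t hs ht => simp only [pr_add_left, map_add, hs, ht]
  | pure y₁ y₂ φ a b => simp only [pr_mp_left, ev_mp, h]

lemma day_hom_ext_right {F G H K : LinFun R X} {η θ : day F (day G H) ⟶ K}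
    (h : ∀ (x y z : X) (a : F.El x) (b : G.El y) (c : H.El z),
      ev η _ (pr a (pr b c)) = ev θ _ (pr a (pr b c))) : η = θ := by
  apply day_hom_ext
  intro y z a t
  induction t using day_induction with
  | zero => simp only [pr_zero_right, map_zero]
  | add s t hs ht => simp only [pr_add_right, map_add, hs, ht]
  | pure y₁ y₂ φ b c => simp only [pr_mp_right, ev_mp, h]

variable (R X) in
/-- The unit object `X(𝟙, -)` of `𝓕`. -/
def dayUnit : LinFun R X where
  functor := (linearCoyoneda R X).obj (Opposite.op (𝟙_ X))
  additive := inferInstance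
  linear := ⟨fun f r => by ext g; exact Linear.comp_smul _ _ _ _ _ _⟩

/-- The values of the unit object. -/
def unitEl (x : X) : (dayUnit R X).El x ≃ₗ[R] (𝟙_ X ⟶ x) := LinearEquiv.refl R (𝟙_ X ⟶ x)

lemma unitEl_mp {x y : X} (f : x ⟶ y) (u : (dayUnit R X).El x) :
    unitEl y ((dayUnit R X).mp f u) = unitEl x u ≫ f := rfl

variable (R X) in
/-- The identity of `𝟙`, as an element of the unit object. -/
def unitOne : (dayUnit R X).El (𝟙_ X) := (unitEl (𝟙_ X)).symm (𝟙 (𝟙_ X))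

@[simp] lemma unitEl_unitOne : unitEl (𝟙_ X) (unitOne R X) = 𝟙 (𝟙_ X) := rfl

lemma mp_unitOne {x : X} (u : (dayUnit R X).El x) :
    (dayUnit R X).mp (unitEl x u) (unitOne R X) = u := by
  apply (unitEl x).injective
  rw [unitEl_mp, unitEl_unitOne, Category.id_comp]

/-- The left unitor `u ⊗ b ↦ F((u ⊗ z) ∘ λ⁻¹)(b)`. -/
def leftUnitHom (F : LinFun R X) : day (dayUnit R X) F ⟶ F :=
  dayLift (fun y z u b => F.mp ((λ_ z).inv ≫ unitEl y u ▷ z) b)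
    (by
      intro y z u v b
      rw [map_add, MonoidalPreadditive.add_whiskerRight, Preadditive.comp_add, mp_add])
    (by
      intro y z r u b
      rw [map_smul, MonoidalLinear.smul_whiskerRight, Linear.comp_smul, mp_smul])
    (by intros; rw [map_add]) (by intros; rw [map_smul])
    (by
      intro y z y' z' f g u b
      rw [unitEl_mp, ← mp_comp, ← mp_comp]
      refine mp_congr _ ?_ _
      simp [MonoidalCategory.tensorHom_def, ← whisker_exchange, ← whisker_exchange_assoc])

@[simp] lemma leftUnitHom_pr (F : LinFun R X) {y z : X} (u : (dayUnit R X).El y) (b : F.El z) :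
    ev (leftUnitHom F) _ (pr u b) = F.mp ((λ_ z).inv ≫ unitEl y u ▷ z) b :=
  dayLift_pr _ _ _ _ _ _ _ _ _ _

/-- The inverse of the left unitor. -/
def leftUnitInv (F : LinFun R X) : F ⟶ day (dayUnit R X) F :=
  homMk (fun x => ((day (dayUnit R X) F).mp (λ_ x).hom).comp
      (prLin (dayUnit R X) F (𝟙_ X) x (unitOne R X)))
    (by
      intro x y f b
      change (day (dayUnit R X) F).mp (λ_ y).hom (pr (unitOne R X) (F.mp f b)) =
        (day (dayUnit R X) F).mp f ((day (dayUnit R X) F).mp (λ_ x).hom (pr (unitOne R X) b))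
      rw [pr_mp_right, ← mp_comp, ← mp_comp, leftUnitor_naturality])

lemma leftUnitInv_ev (F : LinFun R X) {x : X} (b : F.El x) :
    ev (leftUnitInv F) x b = (day (dayUnit R X) F).mp (λ_ x).hom (pr (unitOne R X) b) := rfl

/-- The right unitor `a ⊗ u ↦ F((y ⊗ u) ∘ ρ⁻¹)(a)`. -/
def rightUnitHom (F : LinFun R X) : day F (dayUnit R X) ⟶ F :=
  dayLift (fun y z a u => F.mp ((ρ_ y).inv ≫ y ◁ unitEl z u) a)
    (by intros; rw [map_add]) (by intros; rw [map_smul])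
    (by
      intro y z a u v
      rw [map_add, MonoidalPreadditive.whiskerLeft_add, Preadditive.comp_add, mp_add])
    (by
      intro y z r a u
      rw [map_smul, MonoidalLinear.whiskerLeft_smul, Linear.comp_smul, mp_smul])
    (by
      intro y z y' z' f g a u
      rw [unitEl_mp, ← mp_comp, ← mp_comp]
      refine mp_congr _ ?_ _
      simp [MonoidalCategory.tensorHom_def', whisker_exchange, whisker_exchange_assoc])

@[simp] lemma rightUnitHom_pr (F : LinFun R X) {y z : X} (a : F.El y) (u : (dayUnit R X).El z) :
    ev (rightUnitHom F) _ (pr a u) = F.mp ((ρ_ y).inv ≫ y ◁ unitEl z u) a :=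
  dayLift_pr _ _ _ _ _ _ _ _ _ _

/-- The inverse of the right unitor. -/
def rightUnitInv (F : LinFun R X) : F ⟶ day F (dayUnit R X) :=
  homMk (fun x => ((day F (dayUnit R X)).mp (ρ_ x).hom).comp
      ((prLin F (dayUnit R X) x (𝟙_ X)).flip (unitOne R X)))
    (by
      intro x y f b
      change (day F (dayUnit R X)).mp (ρ_ y).hom (pr (F.mp f b) (unitOne R X)) =
        (day F (dayUnit R X)).mp f ((day F (dayUnit R X)).mp (ρ_ x).hom (pr b (unitOne R X)))
      rw [pr_mp_left, ← mp_comp, ← mp_comp, rightUnitor_naturality])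

lemma rightUnitInv_ev (F : LinFun R X) {x : X} (b : F.El x) :
    ev (rightUnitInv F) x b = (day F (dayUnit R X)).mp (ρ_ x).hom (pr b (unitOne R X)) := rfl

instance : MonoidalCategoryStruct (LinFun R X) where
  tensorObj F G := day F G
  tensorHom η θ := dayHom η θ
  whiskerLeft F _ _ η := dayHom (𝟙 F) η
  whiskerRight η F := dayHom η (𝟙 F)
  tensorUnit := dayUnit R X
  associator F G H :=
    { hom := assocHom F G H
      inv := assocInv F G H
      hom_inv_id := day_hom_ext_left (by
        intro x y z a b c
        rw [ev_comp, assocHom_pr, ev_mp, assocInv_pr, ← mp_comp, Iso.hom_inv_id, mp_id, ev_id])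
      inv_hom_id := day_hom_ext_right (by
        intro x y z a b c
        rw [ev_comp, assocInv_pr, ev_mp, assocHom_pr, ← mp_comp, Iso.inv_hom_id, mp_id, ev_id]) }
  leftUnitor F :=
    { hom := leftUnitHom F
      inv := leftUnitInv F
      hom_inv_id := day_hom_ext (by
        intro y z u b
        rw [ev_comp, leftUnitHom_pr, ev_mp, leftUnitInv_ev, ← mp_comp, Iso.hom_inv_id_assoc,
          ← pr_mp_left, mp_unitOne, ev_id])
      inv_hom_id := hom_ext (by
        intro x b
        rw [ev_comp, leftUnitInv_ev, ev_mp, leftUnitHom_pr, ← mp_comp]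
        simp) }
  rightUnitor F :=
    { hom := rightUnitHom F
      inv := rightUnitInv F
      hom_inv_id := day_hom_ext (by
        intro y z a u
        rw [ev_comp, rightUnitHom_pr, ev_mp, rightUnitInv_ev, ← mp_comp, Iso.hom_inv_id_assoc,
          ← pr_mp_right, mp_unitOne, ev_id])
      inv_hom_id := hom_ext (by
        intro x b
        rw [ev_comp, rightUnitInv_ev, ev_mp, rightUnitHom_pr, ← mp_comp]
        simp) }

/-- The monoidal category `𝓕`. -/
instance : MonoidalCategory (LinFun R X) :=
  MonoidalCategory.ofTensorHom
    (id_tensorHom_id := fun F G => day_hom_ext (by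
      intro y z a b
      change ev (dayHom (𝟙 F) (𝟙 G)) _ _ = _
      rw [dayHom_pr, ev_id, ev_id]; rfl))
    (id_tensorHom := fun _ _ _ _ => rfl)
    (tensorHom_id := fun _ _ => rfl)
    (tensorHom_comp_tensorHom := fun f₁ f₂ g₁ g₂ => day_hom_ext (by
      intro y z a b
      change ev (dayHom g₁ g₂) _ (ev (dayHom f₁ f₂) _ _) = ev (dayHom (f₁ ≫ g₁) (f₂ ≫ g₂)) _ _
      rw [dayHom_pr, dayHom_pr, dayHom_pr, ev_comp, ev_comp]))
    (associator_naturality := fun {F₁ F₂ F₃ G₁ G₂ G₃} f₁ f₂ f₃ => day_hom_ext_left (by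
      intro x y z a b c
      change ev (assocHom G₁ G₂ G₃) _ (ev (dayHom (dayHom f₁ f₂) f₃) _ _) =
        ev (dayHom f₁ (dayHom f₂ f₃)) _ (ev (assocHom F₁ F₂ F₃) _ _)
      rw [dayHom_pr, dayHom_pr, assocHom_pr, assocHom_pr, ev_mp, dayHom_pr, dayHom_pr]))
    (leftUnitor_naturality := fun {F G} f => day_hom_ext (by
      intro y z u b
      change ev (leftUnitHom G) _ (ev (dayHom (𝟙 (dayUnit R X)) f) _ _) =
        ev f _ (ev (leftUnitHom F) _ _)
      rw [dayHom_pr, leftUnitHom_pr, leftUnitHom_pr, ev_mp, ev_id]))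
    (rightUnitor_naturality := fun {F G} f => day_hom_ext (by
      intro y z u b
      change ev (rightUnitHom G) _ (ev (dayHom f (𝟙 (dayUnit R X))) _ _) =
        ev f _ (ev (rightUnitHom F) _ _)
      rw [dayHom_pr, rightUnitHom_pr, rightUnitHom_pr, ev_mp, ev_id]))
    (pentagon := fun F G H K => day_hom_ext_left (by
      intro x y z t c d
      change ev (dayHom (𝟙 F) (assocHom G H K)) _ (ev (assocHom F (day G H) K) _
          (ev (dayHom (assocHom F G H) (𝟙 K)) _ (pr (pr t c) d))) =
        ev (assocHom F G (day H K)) _ (ev (assocHom (day F G) H K) _ (pr (pr t c) d))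
      induction t using day_induction with
      | zero => simp only [pr_zero_left, map_zero]
      | add s t hs ht => simp only [pr_add_left, map_add, hs, ht]
      | pure y₁ y₂ φ a b =>
        simp only [pr_mp_left, ev_mp]
        congr 1
        simp only [dayHom_pr, assocHom_pr, ev_id, pr_mp_left, ev_mp, pr_mp_right, ← mp_comp]
        congr 2
        simp))
    (triangle := fun F G => day_hom_ext_left (by
      intro x y z a u b
      change ev (dayHom (𝟙 F) (leftUnitHom G)) _ (ev (assocHom F (dayUnit R X) G) _ _) =
        ev (dayHom (rightUnitHom F) (𝟙 G)) _ _
      simp only [dayHom_pr, assocHom_pr, ev_id, leftUnitHom_pr, rightUnitHom_pr, pr_mp_left,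
        ev_mp, pr_mp_right, ← mp_comp]
      congr 2
      simp))

end Structure

/-! ### Monoids and modules in `𝓕` -/

section Modules

variable [MonoidalPreadditive X] [MonoidalLinear R X] {A : LinFun R X} [MonObj A]

/-- The product `a × b ∈ A(y ⊗ z)` of `a ∈ A(y)` and `b ∈ A(z)`. -/
def mulE {y z : X} (a : A.El y) (b : A.El z) : A.El (y ⊗ z) :=
  ev (MonObj.mul : A ⊗ A ⟶ A) (y ⊗ z) (pr a b)

variable (A) in
/-- The identity element in `A(𝟙)`. -/
def oneE : A.El (𝟙_ X) := ev (MonObj.one : 𝟙_ (LinFun R X) ⟶ A) (𝟙_ X) (unitOne R X)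

/-- The product `a × m ∈ M(y ⊗ z)` of `a ∈ A(y)` and `m ∈ M(z)`, for an `A`-module `M`. -/
def act {M : Mod (LinFun R X) A} {y z : X} (a : A.El y) (m : M.X.El z) : M.X.El (y ⊗ z) :=
  ev (F := day A M.X) (ModObj.smul (M := A) (X := M.X)) (y ⊗ z) (pr a m)

section

variable {M : Mod (LinFun R X) A} {x y z : X}

lemma act_add_left (a a' : A.El y) (m : M.X.El z) : act (a + a') m = act a m + act a' m := by
  rw [act, pr_add_left, map_add]; rfl

lemma act_smul_left (r : R) (a : A.El y) (m : M.X.El z) : act (r • a) m = r • act a m := by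
  rw [act, pr_smul_left, map_smul]; rfl

lemma act_add_right (a : A.El y) (m m' : M.X.El z) : act a (m + m') = act a m + act a m' := by
  rw [act, pr_add_right, map_add]; rfl

lemma act_smul_right (r : R) (a : A.El y) (m : M.X.El z) : act a (r • m) = r • act a m := by
  rw [act, pr_smul_right, map_smul]; rfl

lemma act_mp {y' z' : X} (f : y ⟶ y') (g : z ⟶ z') (a : A.El y) (m : M.X.El z) :
    act (A.mp f a) (M.X.mp g m) = M.X.mp (f ⊗ₘ g) (act a m) := by
  rw [act, pr_mp, ev_mp]; rfl

lemma act_mp_right {z' : X} (g : z ⟶ z') (a : A.El y) (m : M.X.El z) :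
    act a (M.X.mp g m) = M.X.mp (y ◁ g) (act a m) := by
  rw [act, pr_mp_right, ev_mp]; rfl

lemma act_mp_left {y' : X} (f : y ⟶ y') (a : A.El y) (m : M.X.El z) :
    act (A.mp f a) m = M.X.mp (f ▷ z) (act a m) := by
  rw [act, pr_mp_left, ev_mp]; rfl

lemma one_act (m : M.X.El z) : act (oneE A) m = M.X.mp (λ_ z).inv m := by
  have h := congrArg (fun η : day (dayUnit R X) M.X ⟶ M.X => ev η _ (pr (unitOne R X) m))
    (ModObj.one_smul (M := A) M.X)
  change ev (F := day A M.X) (ModObj.smul (M := A) (X := M.X)) _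
    (ev (dayHom (MonObj.one : 𝟙_ (LinFun R X) ⟶ A) (𝟙 M.X)) _ (pr (unitOne R X) m)) =
      ev (leftUnitHom M.X) _ (pr (unitOne R X) m) at h
  rw [dayHom_pr, leftUnitHom_pr, unitEl_unitOne, id_whiskerRight, Category.comp_id, ev_id] at h
  exact h

lemma mul_act (a : A.El x) (b : A.El y) (m : M.X.El z) :
    act (mulE a b) m = M.X.mp (α_ x y z).inv (act a (act b m)) := by
  have h := congrArg (fun η : day (day A A) M.X ⟶ M.X => ev η _ (pr (pr a b) m))
    (ModObj.mul_smul (M := A) M.X)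
  let σ : day A M.X ⟶ M.X := ModObj.smul (M := A) (X := M.X)
  let μ : day A A ⟶ A := MonObj.mul
  change ev σ _ (ev (dayHom μ (𝟙 M.X)) _ (pr (pr a b) m)) =
      ev σ _ (ev (dayHom (𝟙 A) σ) _ (ev (assocHom A A M.X) _ (pr (pr a b) m))) at h
  rw [assocHom_pr, ev_mp, ev_mp, dayHom_pr, dayHom_pr, ev_id, ev_id] at h
  exact h

/-- `m ↦ a × m` as a linear map. -/
def actLin {M : Mod (LinFun R X) A} {y : X} (a : A.El y) (z : X) :
    M.X.El z →ₗ[R] M.X.El (y ⊗ z) where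
  toFun m := act a m
  map_add' := act_add_right a
  map_smul' r m := act_smul_right r a m

@[simp] lemma actLin_apply (a : A.El y) (m : M.X.El z) : actLin a z m = act a m := rfl

end

/-- Build an `A`-module from a natural bilinear pairing that is unital and associative. -/
def modOfAct (M : LinFun R X) (p : ∀ (y z : X), A.El y → M.El z → M.El (y ⊗ z))
    (left_add : ∀ y z a a' b, p y z (a + a') b = p y z a b + p y z a' b)
    (left_smul : ∀ y z (r : R) a b, p y z (r • a) b = r • p y z a b)
    (right_add : ∀ y z a b b', p y z a (b + b') = p y z a b + p y z a b')
    (right_smul : ∀ y z (r : R) a b, p y z a (r • b) = r • p y z a b)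
    (nat : ∀ y z y' z' (f : y ⟶ y') (g : z ⟶ z') a b,
      p y' z' (A.mp f a) (M.mp g b) = M.mp (f ⊗ₘ g) (p y z a b))
    (one : ∀ z m, p (𝟙_ X) z (oneE A) m = M.mp (λ_ z).inv m)
    (mul : ∀ x y z a b m, p (x ⊗ y) z (mulE a b) m =
      M.mp (α_ x y z).inv (p x (y ⊗ z) a (p y z b m))) :
    Mod (LinFun R X) A where
  X := M
  mod :=
    { smul := dayLift p left_add left_smul right_add right_smul nat
      one_smul := day_hom_ext (F := dayUnit R X) (G := M) (by
        intro y z u m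
        change ev (dayLift p left_add left_smul right_add right_smul nat) _
          (ev (dayHom (MonObj.one : 𝟙_ (LinFun R X) ⟶ A) (𝟙 M)) _ (pr u m)) =
            ev (leftUnitHom M) _ (pr u m)
        rw [dayHom_pr, leftUnitHom_pr, dayLift_pr, ev_id]
        have hu : ev (MonObj.one : 𝟙_ (LinFun R X) ⟶ A) y u = A.mp (unitEl y u) (oneE A) := by
          rw [oneE, ← ev_mp]
          exact congrArg _ (mp_unitOne u).symm
        have h := nat _ _ _ _ (unitEl y u) (𝟙 z) (oneE A) m
        rw [mp_id, one, ← mp_comp, tensorHom_id] at h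
        rw [← h]
        exact congrArg (fun c => p y z c m) hu)
      mul_smul := day_hom_ext_left (F := A) (G := A) (H := M) (by
        intro x y z a b m
        change ev (dayLift p left_add left_smul right_add right_smul nat) _
          (ev (dayHom (MonObj.mul : A ⊗ A ⟶ A) (𝟙 M)) _ (pr (pr a b) m)) =
            ev (dayLift p left_add left_smul right_add right_smul nat) _
              (ev (dayHom (𝟙 A) (dayLift p left_add left_smul right_add right_smul nat)) _
                (ev (assocHom A A M) _ (pr (pr a b) m)))
        rw [assocHom_pr, ev_mp, ev_mp, dayHom_pr, dayHom_pr, dayLift_pr, dayLift_pr, dayLift_pr,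
          ev_id, ev_id]
        exact mul x y z a b m) }

/-- Build a morphism of `A`-modules from its components. -/
def modHomMk {M N : Mod (LinFun R X) A} (η : ∀ x, M.X.El x →ₗ[R] N.X.El x)
    (nat : ∀ x y (f : x ⟶ y) (m : M.X.El x), η y (M.X.mp f m) = N.X.mp f (η x m))
    (hact : ∀ y z (a : A.El y) (m : M.X.El z), η (y ⊗ z) (act a m) = act a (η z m)) : M ⟶ N :=
  Mod.Hom.mk' (homMk η (fun f m => nat _ _ f m)) (day_hom_ext (F := A) (G := M.X) (by
    intro y z a m
    change η (y ⊗ z) (act a m) =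
      ev (F := day A N.X) (ModObj.smul (M := A) (X := N.X)) _
        (ev (dayHom (𝟙 A) (homMk η (fun f m => nat _ _ f m))) _ (pr a m))
    rw [dayHom_pr, hact]
    rfl))

/-- The component at `x` of a morphism of `A`-modules. -/
def mev {M N : Mod (LinFun R X) A} (f : M ⟶ N) (x : X) : M.X.El x →ₗ[R] N.X.El x := ev f.hom x

/-- Exactness at `N` of `M ⟶ N ⟶ P`. Kernels and images of morphisms of `A`-modules are computed
pointwise in `R`-modules. -/
def ModExact {M N P : Mod (LinFun R X) A} (f : M ⟶ N) (g : N ⟶ P) : Prop :=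
  ∀ x : X, Function.Exact (mev f x) (mev g x)

/-- `A`-submodules of an `A`-module `M`: subfunctors stable under the action of `A`. -/
structure SubMod (M : Mod (LinFun R X) A) where
  carrier : ∀ x : X, Submodule R (M.X.El x)
  mp_mem : ∀ {x y : X} (f : x ⟶ y) {m : M.X.El x}, m ∈ carrier x → M.X.mp f m ∈ carrier y
  act_mem : ∀ {y z : X} (a : A.El y) {m : M.X.El z}, m ∈ carrier z → act a m ∈ carrier (y ⊗ z)

/-- The submodule generated by a set of elements of `M(v)`: the intersection of all submodules
that contain it. -/
def SubMod.generated (M : Mod (LinFun R X) A) {v : X} (S : Set (M.X.El v)) : SubMod M where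
  carrier x := ⨅ N : {N : SubMod M // S ⊆ N.carrier v}, N.1.carrier x
  mp_mem f m hm := by
    rw [Submodule.mem_iInf] at hm ⊢
    exact fun N => N.1.mp_mem f (hm N)
  act_mem a m hm := by
    rw [Submodule.mem_iInf] at hm ⊢
    exact fun N => N.1.act_mem a (hm N)

/-- The functor underlying the quotient module. -/
def SubMod.quotFun {M : Mod (LinFun R X) A} (N : SubMod M) : LinFun R X :=
  ofData (fun x => M.X.El x ⧸ N.carrier x)
    (fun {x y} f => Submodule.mapQ (N.carrier x) (N.carrier y) (M.X.mp f)
      (fun _ hm => N.mp_mem f hm))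
    (fun x a => by
      obtain ⟨a, rfl⟩ := Submodule.Quotient.mk_surjective _ a
      simp)
    (fun f g a => by
      obtain ⟨a, rfl⟩ := Submodule.Quotient.mk_surjective _ a
      simp [mp_comp])
    (fun f g a => by
      obtain ⟨a, rfl⟩ := Submodule.Quotient.mk_surjective _ a
      simp [mp_add])
    (fun r f a => by
      obtain ⟨a, rfl⟩ := Submodule.Quotient.mk_surjective _ a
      simp [mp_smul])

/-- The class in `(M / N)(x)` of an element of `M(x)`. -/
def SubMod.mkQ {M : Mod (LinFun R X) A} (N : SubMod M) (x : X) :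
    M.X.El x →ₗ[R] N.quotFun.El x := (N.carrier x).mkQ

lemma SubMod.mkQ_surjective {M : Mod (LinFun R X) A} (N : SubMod M) (x : X) :
    Function.Surjective (N.mkQ x) := Submodule.mkQ_surjective (N.carrier x)

lemma SubMod.mp_mkQ {M : Mod (LinFun R X) A} (N : SubMod M) {x y : X} (f : x ⟶ y)
    (m : M.X.El x) : N.quotFun.mp f (N.mkQ x m) = N.mkQ y (M.X.mp f m) := rfl

/-- The action of `a ∈ A(y)` on the quotient module. -/
def SubMod.quotAct {M : Mod (LinFun R X) A} (N : SubMod M) {y : X} (a : A.El y) (z : X) :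
    N.quotFun.El z →ₗ[R] N.quotFun.El (y ⊗ z) :=
  Submodule.mapQ (N.carrier z) (N.carrier (y ⊗ z)) (actLin a z) (fun _ hm => N.act_mem a hm)

lemma SubMod.quotAct_mkQ {M : Mod (LinFun R X) A} (N : SubMod M) {y z : X} (a : A.El y)
    (m : M.X.El z) : N.quotAct a z (N.mkQ z m) = N.mkQ (y ⊗ z) (act a m) := rfl

/-- The quotient module `M / N`. -/
def SubMod.quot {M : Mod (LinFun R X) A} (N : SubMod M) : Mod (LinFun R X) A :=
  modOfAct N.quotFun (fun y z a b => N.quotAct a z b)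
    (by
      intro y z a a' b
      obtain ⟨b, rfl⟩ := N.mkQ_surjective _ b
      simp only [quotAct_mkQ, act_add_left, map_add])
    (by
      intro y z r a b
      obtain ⟨b, rfl⟩ := N.mkQ_surjective _ b
      simp only [quotAct_mkQ, act_smul_left, map_smul])
    (by intros; rw [map_add]) (by intros; rw [map_smul])
    (by
      intro y z y' z' f g a b
      obtain ⟨b, rfl⟩ := N.mkQ_surjective _ b
      simp only [quotAct_mkQ, mp_mkQ, act_mp])
    (by
      intro z b
      obtain ⟨b, rfl⟩ := N.mkQ_surjective _ b
      simp only [quotAct_mkQ, mp_mkQ, one_act])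
    (by
      intro x y z a a' b
      obtain ⟨b, rfl⟩ := N.mkQ_surjective _ b
      simp only [quotAct_mkQ, mp_mkQ, mul_act])

/-- The projection `M ⟶ M / N`. -/
def SubMod.proj {M : Mod (LinFun R X) A} (N : SubMod M) : M ⟶ N.quot :=
  modHomMk (N := N.quot) N.mkQ (fun _ _ f m => (N.mp_mkQ f m).symm)
    (fun y z a m => by
      have h : act (M := N.quot) a (N.mkQ z m) = N.quotAct a z (N.mkQ z m) :=
        dayLift_pr _ _ _ _ _ _ _ _ _ _
      exact h.symm)

/-- The functor `⨁_{i ∈ I} F`, for a finite set `I`. -/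
def powFun (I : Type) [Finite I] (F : LinFun R X) : LinFun R X :=
  ofData (fun x => I → F.El x) (fun f => (F.mp f).compLeft I)
    (fun x a => by ext i; simp)
    (fun f g a => by ext i; simp [mp_comp])
    (fun f g a => by ext i; simp [mp_add])
    (fun r f a => by ext i; simp [mp_smul])

/-- The module `⨁_{i ∈ I} M`, for a finite set `I`. -/
def powMod (I : Type) [Finite I] (M : Mod (LinFun R X) A) : Mod (LinFun R X) A :=
  modOfAct (powFun I M.X) (fun _ z a (b : I → M.X.El z) => fun i => act a (b i))
    (fun _ _ a a' _ => funext fun _ => act_add_left a a' _)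
    (fun _ _ r a _ => funext fun _ => act_smul_left r a _)
    (fun _ _ a _ _ => funext fun _ => act_add_right a _ _)
    (fun _ _ r a _ => funext fun _ => act_smul_right r a _)
    (fun _ _ _ _ f g a _ => funext fun _ => act_mp f g a _)
    (fun _ _ => funext fun _ => one_act _)
    (fun _ _ _ a a' _ => funext fun _ => mul_act a a' _)

lemma powMod_mp {I : Type} [Finite I] {M : Mod (LinFun R X) A} {x y : X} (f : x ⟶ y)
    (b : I → M.X.El x) : (powMod I M).X.mp f b = fun i => M.X.mp f (b i) := rfl

lemma powMod_act {I : Type} [Finite I] {M : Mod (LinFun R X) A} {y z : X} (a : A.El y)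
    (b : I → M.X.El z) : act (M := powMod I M) a b = fun i => act a (b i) :=
  dayLift_pr (F := A) (G := powFun I M.X) (H := powFun I M.X) _ _ _ _ _ _ _ _ _ _

/-- The projection onto the summand `i`. -/
def powProj {I : Type} [Finite I] (M : Mod (LinFun R X) A) (i : I) : powMod I M ⟶ M :=
  modHomMk (M := powMod I M)
    (fun x => LinearMap.proj (R := R) (φ := fun _ : I => M.X.El x) i) (fun _ _ _ _ => rfl)
    (fun _ _ a b => congrFun (powMod_act (M := M) a b) i)

/-- The inclusion of the summand `i`. -/
def powIncl {I : Type} [Finite I] [DecidableEq I] (M : Mod (LinFun R X) A) (i : I) : M ⟶ powMod I M :=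
  modHomMk (N := powMod I M)
    (fun x => LinearMap.single R (fun _ : I => M.X.El x) i)
    (fun x y f m => by
      funext j
      change Pi.single (M := fun _ : I => M.X.El y) i (M.X.mp f m) j =
        M.X.mp f (Pi.single (M := fun _ : I => M.X.El x) i m j)
      by_cases h : j = i
      · subst h; simp
      · simp [h])
    (fun y z a m => by
      refine Eq.trans ?_ (powMod_act (M := M) a _).symm
      funext j
      change Pi.single (M := fun _ : I => M.X.El (y ⊗ z)) i (actLin a z m) j =
        actLin a z (Pi.single (M := fun _ : I => M.X.El z) i m j)
      by_cases h : j = i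
      · subst h; simp
      · rw [Pi.single_eq_of_ne h, Pi.single_eq_of_ne h, map_zero])

lemma powProj_apply {I : Type} [Finite I] (M : Mod (LinFun R X) A) (i : I) {x : X}
    (b : I → M.X.El x) : mev (powProj M i) x b = b i := rfl

lemma powIncl_apply {I : Type} [Finite I] [DecidableEq I] (M : Mod (LinFun R X) A) (i : I)
    {x : X} (m : M.X.El x) :
    mev (powIncl M i) x m = (Pi.single i m : I → M.X.El x) := rfl

lemma mev_mp {M N : Mod (LinFun R X) A} (f : M ⟶ N) {x y : X} (g : x ⟶ y) (m : M.X.El x) :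
    mev f y (M.X.mp g m) = N.X.mp g (mev f x m) := ev_mp f.hom g m

lemma mev_act {M N : Mod (LinFun R X) A} (f : M ⟶ N) {y z : X} (a : A.El y) (m : M.X.El z) :
    mev f (y ⊗ z) (act a m) = act a (mev f z m) := by
  let σ : day A M.X ⟶ M.X := ModObj.smul (M := A) (X := M.X)
  let τ : day A N.X ⟶ N.X := ModObj.smul (M := A) (X := N.X)
  have h := congrArg (fun k : day A M.X ⟶ N.X => ev k _ (pr a m))
    (IsModHom.smul_hom (A := A) (f := f.hom))
  change ev f.hom _ (ev σ _ (pr a m)) = ev τ _ (ev (dayHom (𝟙 A) f.hom) _ (pr a m)) at h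
  rw [dayHom_pr, ev_id] at h
  exact h

variable (A) in
/-- `A` as a module over itself. -/
abbrev regMod : Mod (LinFun R X) A where
  X := A
  mod := ModObj.regular A

lemma regMod_act {y z : X} (a : A.El y) (b : A.El z) : act (M := regMod A) a b = mulE a b := rfl

end Modules

/-! ### The Koszul complex -/

section Koszul

variable [MonoidalPreadditive X] [MonoidalLinear R X] [SymmetricCategory X]

/-- The commutant `CA(x)`: the `b ∈ A(x)` with `a × b = A(s)(b × a)` for all `y` and `a ∈ A(y)`,
where `s : x ⊗ y ⟶ y ⊗ x` is the symmetry. -/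
def commutant (A : LinFun R X) [MonObj A] (x : X) : Submodule R (A.El x) where
  carrier := {b | ∀ (y : X) (a : A.El y), mulE a b = A.mp (β_ x y).hom (mulE b a)}
  add_mem' {b c} hb hc y a := by
    rw [← regMod_act, ← regMod_act, act_add_right, act_add_left, map_add]
    exact congrArg₂ _ (hb y a) (hc y a)
  zero_mem' y a := by
    rw [← regMod_act, ← regMod_act, ← zero_smul R (0 : A.El x), act_smul_right, act_smul_left]
    simp
  smul_mem' r b hb y a := by
    rw [← regMod_act, ← regMod_act, act_smul_right, act_smul_left, map_smul]
    exact congrArg _ (hb y a)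

variable {A : LinFun R X} [MonObj A]

/-- Multiplication `L_a : A ⟶ A` by `a ∈ CA(𝟙)`, given by `b ↦ A(λ_x)(a × b)`. -/
def mulLeft (a : commutant A (𝟙_ X)) : regMod A ⟶ regMod A :=
  modHomMk (fun x => (A.mp (λ_ x).hom).comp (actLin (M := regMod A) a.1 x))
    (by
      intro x y f b
      change A.mp (λ_ y).hom (act (M := regMod A) a.1 (A.mp f b)) =
        A.mp f (A.mp (λ_ x).hom (act (M := regMod A) a.1 b))
      rw [act_mp_right, ← mp_comp, ← mp_comp, leftUnitor_naturality])
    (by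
      intro y z c b
      change A.mp (λ_ (y ⊗ z)).hom (act (M := regMod A) a.1 (act (M := regMod A) c b)) =
        act (M := regMod A) c (A.mp (λ_ z).hom (act (M := regMod A) a.1 b))
      have h₁ := mul_act (M := regMod A) a.1 c b
      have h₂ := mul_act (M := regMod A) c a.1 b
      rw [a.2 y c, act_mp_left, h₁] at h₂
      have h₃ := congrArg ((regMod A).X.mp (α_ y (𝟙_ X) z).hom) h₂
      rw [← mp_comp, ← mp_comp, ← mp_comp, Iso.inv_hom_id, mp_id] at h₃
      rw [act_mp_right, ← h₃, ← mp_comp]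
      refine mp_congr _ ?_ _
      simp [← comp_whiskerRight])

/-- The subsets of `{1, …, n}` with `p` elements. -/
abbrev KIdx (n p : ℕ) : Type := {S : Finset (Fin n) // S.card = p}

/-- The subset `S ∖ {i}` for `i ∈ S`. -/
def KIdx.erase {n p : ℕ} (S : KIdx n (p + 1)) (i : S.1) : KIdx n p :=
  ⟨S.1.erase i, by rw [Finset.card_erase_of_mem i.2, S.2, Nat.add_sub_cancel]⟩

/-- The position of `i` in `S = {i_1 < … < i_p}`, counted from `0`. -/
def KIdx.pos {n p : ℕ} (S : KIdx n p) (i : S.1) : ℕ := (S.1.filter (fun j => j < i.1)).card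

variable (A) in
/-- The module `K_p^n(A)`, the direct sum of copies of `A` over the `p`-subsets of `{1, …, n}`. -/
abbrev koszul (n p : ℕ) : Mod (LinFun R X) A := powMod (KIdx n p) (regMod A)

/-- The component at `x` of the Koszul differential. On the summand `A_S`, for
`S = {i_1 < … < i_{p+1}}`, it is the sum over `k` of `(-1)^(k+1)` times multiplication by
`α_{i_k}` into the summand of `S ∖ {i_k}`. -/
def koszulDEl {n : ℕ} (α : Fin n → commutant A (𝟙_ X)) (p : ℕ) (x : X) :
    (koszul A n (p + 1)).X.El x →ₗ[R] (koszul A n p).X.El x :=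
  ∑ S : KIdx n (p + 1), ∑ i : S.1, (-1 : R) ^ S.pos i •
    mev (powProj (regMod A) S ≫ mulLeft (α i) ≫ powIncl (regMod A) (S.erase i)) x

/-- The Koszul differential `d : K_{p+1}^n(A) ⟶ K_p^n(A)`. -/
def koszulD {n : ℕ} (α : Fin n → commutant A (𝟙_ X)) (p : ℕ) :
    koszul A n (p + 1) ⟶ koszul A n p :=
  modHomMk (koszulDEl α p)
    (fun x y f b => by
      simp only [koszulDEl, LinearMap.sum_apply, LinearMap.smul_apply, map_sum, map_smul, mev_mp])
    (fun y z a b => by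
      rw [← actLin_apply a (koszulDEl α p z b)]
      simp only [koszulDEl, LinearMap.sum_apply, LinearMap.smul_apply, map_sum, map_smul,
        mev_act, actLin_apply])

variable (A) in
/-- The identification `K_0^n(A) = A`. -/
def koszulZero (n : ℕ) : koszul A n 0 ≅ regMod A where
  hom := powProj (regMod A) ⟨∅, Finset.card_empty⟩
  inv := powIncl (regMod A) ⟨∅, Finset.card_empty⟩
  hom_inv_id := by
    apply Mod.Hom.ext
    apply hom_ext
    intro x b
    funext S
    obtain ⟨S, hS⟩ := S
    obtain rfl := Finset.card_eq_zero.1 hS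
    exact Pi.single_eq_same (M := fun _ : KIdx n 0 => A.El x) (⟨∅, Finset.card_empty⟩ : KIdx n 0)
      (b ⟨∅, Finset.card_empty⟩ : A.El x)
  inv_hom_id := by
    apply Mod.Hom.ext
    apply hom_ext
    intro x b
    exact Pi.single_eq_same (M := fun _ : KIdx n 0 => A.El x) (⟨∅, Finset.card_empty⟩ : KIdx n 0)
      (b : A.El x)

/-- The morphism `L_α : A^n ⟶ A`, the last differential of the Koszul complex. -/
def koszulL {n : ℕ} (α : Fin n → commutant A (𝟙_ X)) : koszul A n 1 ⟶ regMod A :=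
  koszulD α 0 ≫ (koszulZero A n).hom

/-- The submodule `A⟨α_i, i ∈ I⟩` of `A` generated by the `α_i` with `i ∈ I`. -/
def spanSub {n : ℕ} (α : Fin n → commutant A (𝟙_ X)) (I : Set (Fin n)) : SubMod (regMod A) :=
  SubMod.generated (regMod A) (v := 𝟙_ X) ((fun i => (α i : A.El (𝟙_ X))) '' I)

/-- `a` is `M`-regular. -/
def IsRegularOn (M : Mod (LinFun R X) A) (a : commutant A (𝟙_ X)) : Prop :=
  ∀ (x : X) (m : M.X.El x), m ≠ 0 → act a.1 m ≠ 0

/-- Regular sequences: `α_i` is regular on `A / A⟨α_1, …, α_{i-1}⟩` for all `i`, and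
`A / A⟨α_1, …, α_n⟩` is not zero. -/
structure IsRegularSeq {n : ℕ} (α : Fin n → commutant A (𝟙_ X)) : Prop where
  regular : ∀ i : Fin n, IsRegularOn (spanSub α {j | j < i}).quot (α i)
  nonzero : ∃ x : X, Nontrivial ((spanSub α Set.univ).quot.X.El x)

end Koszul


end Day

end LinFun

end

/-! Exactness of a sequence of `A`-modules is tested at each object `x`, and there the problem
becomes the classical one about a single `R`-module. The maps `L_{α_i}` give `R`-linear
endomorphisms `ℓ i` of `V = A(x)`. They commute because `α_i` lies in the commutant: this makes
`L_{α_i}` a morphism of left `A`-modules, so that it passes through multiplication by `α_j`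
(`mulLeft_comm`). The submodule generated by a set of the `α_i` has as value at `x` the sum of the
images of the corresponding `ℓ i` (`spanSub_carrier`). Regularity therefore says that `ℓ i v ∈ ∑_{j
< i} ℓ j V` forces `v ∈ ∑_{j < i} ℓ j V` (`IsRegularSeq.mem_range`).

For such a family, acyclicity in positive degrees is proved in `exists_diff_eq` by induction on the
set of indices, adding a new largest index `a`. A chain for `s ∪ {a}` is a pair of chains for `s`:
its values at the sets without `a` and at the sets with `a`. In these terms the complex is the
mapping cone of `± ℓ a` on the complex for `s`. The only obstruction to lifting a cycle lies in
degree `0` of the part with `a`, where `ℓ a` must be injective modulo the images of the earlier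
endomorphisms.

To avoid dependent types, chains of all degrees are handled together as functions `Finset ι → V`.
The graded complex is recovered by extension by zero and restriction (`sum_single_erase`,
`exact_graded`). -/

/-! ### The Koszul complex of a family of commuting endomorphisms -/

namespace KoszulEnd

variable {R : Type*} [CommRing R] {V : Type*} [AddCommGroup V] [Module R V]
  {ι : Type*} [LinearOrder ι]

/-- The map `(c_j) ↦ ∑_{j ∈ s} ℓ_j(c_j)`. -/
def total (ℓ : ι → Module.End R V) (s : Finset ι) : (ι → V) →ₗ[R] V :=
  ∑ j ∈ s, ℓ j ∘ₗ LinearMap.proj j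

lemma total_apply (ℓ : ι → Module.End R V) (s : Finset ι) (c : ι → V) :
    total ℓ s c = ∑ j ∈ s, ℓ j (c j) := by
  simp [total, LinearMap.sum_apply]

lemma apply_mem_range_total (ℓ : ι → Module.End R V) {s : Finset ι} {j : ι} (hj : j ∈ s) (v : V) :
    ℓ j v ∈ LinearMap.range (total ℓ s) := by
  refine ⟨Pi.single j v, ?_⟩
  rw [total_apply, Finset.sum_eq_single_of_mem j hj]
  · simp
  · intro i _ hij
    simp [Pi.single_eq_of_ne hij]

/-- The sum over `i ∈ s ∖ T` of `± ℓ_i(f(T ∪ {i}))`: the ungraded Koszul differential of the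
family `(ℓ_i)_{i ∈ s}`, on functions of finite sets of indices. -/
def diff (ℓ : ι → Module.End R V) (s : Finset ι) : (Finset ι → V) →ₗ[R] (Finset ι → V) :=
  LinearMap.pi fun T => ∑ i ∈ s \ T,
    (-1 : R) ^ (T.filter (· < i)).card • (ℓ i ∘ₗ LinearMap.proj (insert i T))

lemma diff_apply (ℓ : ι → Module.End R V) (s : Finset ι) (f : Finset ι → V) (T : Finset ι) :
    diff ℓ s f T =
      ∑ i ∈ s \ T, (-1 : R) ^ (T.filter (· < i)).card • ℓ i (f (insert i T)) := by
  simp [diff, LinearMap.sum_apply]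

/-- Only the values at the sets `insert i T` enter, and these are nonempty. Hence a chain may be
changed at `∅`, or outside the subsets of `s`, without affecting its differential. -/
lemma diff_congr (ℓ : ι → Module.End R V) {s T : Finset ι} {f g : Finset ι → V} (hT : T ⊆ s)
    (h : ∀ U ⊆ s, U ≠ ∅ → f U = g U) : diff ℓ s f T = diff ℓ s g T := by
  rw [diff_apply, diff_apply]
  refine Finset.sum_congr rfl fun i hi => ?_
  rw [h _ (Finset.insert_subset (Finset.mem_sdiff.1 hi).1 hT) (Finset.insert_ne_empty _ _)]

lemma diff_empty (ℓ : ι → Module.End R V) (s : Finset ι) (f : Finset ι → V) :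
    diff ℓ s f ∅ = total ℓ s fun i => f {i} := by
  simp [diff_apply, total_apply]

/-- The component of the cone differential at the sets without `a`. All elements of `T` lie below
`a`, so the sign of the new term is `(-1) ^ T.card`. -/
lemma diff_insert_apply (ℓ : ι → Module.End R V) {s T : Finset ι} {a : ι} (ha : ∀ i ∈ s, i < a)
    (hT : T ⊆ s) (f : Finset ι → V) :
    diff ℓ (insert a s) f T = diff ℓ s f T + (-1 : R) ^ T.card • ℓ a (f (insert a T)) := by
  have haT : a ∉ T := fun h => lt_irrefl a (ha a (hT h))
  have has : a ∉ s := fun h => lt_irrefl a (ha a h)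
  rw [diff_apply, diff_apply, Finset.insert_sdiff_of_notMem _ haT,
    Finset.sum_insert (fun h => has (Finset.mem_sdiff.1 h).1), add_comm,
    Finset.filter_true_of_mem (fun i hi => ha i (hT hi))]

/-- The component at the sets with `a`. As `a` exceeds every `i ∈ s`, its presence in `T` does not
change the number of elements below `i`, and the signs agree. -/
lemma diff_insert_apply_insert (ℓ : ι → Module.End R V) {s T : Finset ι} {a : ι}
    (ha : ∀ i ∈ s, i < a) (f : Finset ι → V) :
    diff ℓ (insert a s) f (insert a T) = diff ℓ s (fun U => f (insert a U)) T := by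
  have has : a ∉ s := fun h => lt_irrefl a (ha a h)
  rw [diff_apply, diff_apply]
  have : insert a s \ insert a T = s \ T := by
    ext i
    simp only [Finset.mem_sdiff, Finset.mem_insert]
    grind
  rw [this]
  refine Finset.sum_congr rfl fun i hi => ?_
  rw [Finset.insert_comm, Finset.filter_insert,
    if_neg (not_lt.2 (ha i (Finset.mem_sdiff.1 hi).1).le)]

lemma diff_map {ℓ : ι → Module.End R V} {φ : Module.End R V} (hφ : ∀ i, Commute φ (ℓ i))
    (s : Finset ι) (f : Finset ι → V) (T : Finset ι) :
    diff ℓ s (fun U => φ (f U)) T = φ (diff ℓ s f T) := by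
  simp only [diff_apply, map_sum, map_smul]
  refine Finset.sum_congr rfl fun i _ => ?_
  congr 1
  exact (LinearMap.congr_fun (hφ i) (f (insert i T))).symm

/-- The value at `T` is computed from sets with one more element, so the degree sign anticommutes
with the differential. This produces the cancellations in the cone. -/
lemma diff_sign (ℓ : ι → Module.End R V) (s : Finset ι) (f : Finset ι → V) (T : Finset ι) :
    diff ℓ s (fun U => (-1 : R) ^ U.card • f U) T = -((-1 : R) ^ T.card • diff ℓ s f T) := by
  simp only [diff_apply, Finset.smul_sum, ← Finset.sum_neg_distrib]
  refine Finset.sum_congr rfl fun i hi => ?_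
  rw [Finset.card_insert_of_notMem (Finset.mem_sdiff.1 hi).2, map_smul, pow_succ, mul_neg_one,
    neg_smul, smul_neg, smul_comm]

/-- Induction along the cone: at a set with `a` the claim is the one for `s`. At a set without `a`,
the two terms containing `ℓ a` cancel by `diff_sign` and `diff_map`. -/
lemma diff_diff {ℓ : ι → Module.End R V} (hℓ : ∀ i j, Commute (ℓ i) (ℓ j)) (s : Finset ι)
    (f : Finset ι → V) {T : Finset ι} (hT : T ⊆ s) : diff ℓ s (diff ℓ s f) T = 0 := by
  induction s using Finset.induction_on_max generalizing f T with
  | empty => simp [diff_apply]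
  | insert a s ha ih =>
    have key : ∀ (f : Finset ι → V) {T : Finset ι}, T ⊆ s →
        diff ℓ s (fun U => diff ℓ (insert a s) f (insert a U)) T = 0 := fun f T hT => by
      rw [diff_congr ℓ hT fun U hU _ => diff_insert_apply_insert ℓ ha f]
      exact ih _ hT
    by_cases haT : a ∈ T
    · obtain ⟨U, haU, rfl⟩ : ∃ U, a ∉ U ∧ insert a U = T :=
        ⟨T.erase a, Finset.notMem_erase a T, Finset.insert_erase haT⟩
      have hU : U ⊆ s := (Finset.insert_subset_insert_iff haU).1 hT
      rw [diff_insert_apply_insert ℓ ha, key f hU]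
    · have hT : T ⊆ s := (Finset.subset_insert_iff_of_notMem haT).1 hT
      rw [diff_insert_apply ℓ ha hT, diff_insert_apply_insert ℓ ha,
        diff_congr ℓ hT fun U hU _ => diff_insert_apply ℓ ha hU f]
      change diff ℓ s (diff ℓ s f + fun U => (-1 : R) ^ U.card • ℓ a (f (insert a U))) T + _ = 0
      rw [map_add, Pi.add_apply, ih f hT, diff_sign, diff_map (hℓ a)]
      simp

/-- For a regular sequence of commuting endomorphisms, every cycle of positive degree is a
boundary. -/
lemma exists_diff_eq {ℓ : ι → Module.End R V} (hℓ : ∀ i j, Commute (ℓ i) (ℓ j)) (s : Finset ι)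
    (hreg : ∀ i ∈ s, ∀ v, ℓ i v ∈ LinearMap.range (total ℓ (s.filter (· < i))) →
      v ∈ LinearMap.range (total ℓ (s.filter (· < i))))
    (f : Finset ι → V) (hf₀ : f ∅ = 0) (hf : ∀ T ⊆ s, diff ℓ s f T = 0) :
    ∃ g : Finset ι → V, g ∅ = 0 ∧ ∀ T ⊆ s, diff ℓ s g T = f T := by
  induction s using Finset.induction_on_max generalizing f with
  | empty =>
    refine ⟨0, rfl, fun T hT => ?_⟩
    rw [Finset.subset_empty.1 hT, hf₀]
    simp
  | insert a s ha ih =>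
    have has : a ∉ s := fun h => lt_irrefl a (ha a h)
    -- Adding a largest index leaves the predecessors of the old indices unchanged, and the
    -- predecessors of `a` are all of `s`. So the regularity hypothesis restricts to `s` and yields
    -- the condition on `a` modulo `s`.
    have hlt : ∀ i ∈ s, (insert a s).filter (· < i) = s.filter (· < i) := fun i hi => by
      rw [Finset.filter_insert, if_neg (not_lt.2 (ha i hi).le)]
    have hmax : (insert a s).filter (· < a) = s := by
      rw [Finset.filter_insert, if_neg (lt_irrefl a), Finset.filter_true_of_mem ha]
    have ih := ih fun i hi => by
      rw [← hlt i hi]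
      exact hreg i (Finset.mem_insert_of_mem hi)
    have ha_reg := hreg a (Finset.mem_insert_self a s)
    rw [hmax] at ha_reg
    have hin : ∀ T ⊆ s, diff ℓ s (fun U => f (insert a U)) T = 0 := fun T hT => by
      rw [← diff_insert_apply_insert ℓ ha]
      exact hf _ (Finset.insert_subset_insert a hT)
    have hout : ∀ T ⊆ s, diff ℓ s f T + (-1 : R) ^ T.card • ℓ a (f (insert a T)) = 0 :=
      fun T hT => by
        rw [← diff_insert_apply ℓ ha hT]
        exact hf _ (hT.trans (Finset.subset_insert a s))
    -- The cycle condition at `∅` reads `ℓ a (f {a}) = -∑_{i ∈ s} ℓ i (f {i})`. Regularity of `ℓ a`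
    -- then puts `f {a}` in the sum of the images.
    obtain ⟨c, hc⟩ := ha_reg (f (insert a ∅)) (by
      have h := hout ∅ (Finset.empty_subset s)
      rw [Finset.card_empty, pow_zero, one_smul, diff_empty] at h
      rw [← neg_eq_of_add_eq_zero_right h]
      exact Submodule.neg_mem _ ⟨_, rfl⟩)
    -- Only the values of `e` at singletons matter. Subtracting the differential of `e` kills the
    -- value at `∅` of the part of `f` with `a`, as the induction hypothesis requires.
    obtain ⟨e, he⟩ : ∃ e : Finset ι → V, ∀ i, e {i} = c i :=
      ⟨fun T => if h : T.Nonempty then c (T.min' h) else 0, fun i => by simp⟩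
    obtain ⟨h₁, -, hh₁⟩ := ih ((fun U => f (insert a U)) - diff ℓ s e)
      (by rw [Pi.sub_apply, diff_empty, ← hc]; simp [he])
      (fun T hT => by rw [map_sub, Pi.sub_apply, hin T hT, diff_diff hℓ s e hT, sub_zero])
    obtain ⟨h, h_empty, hh⟩ : ∃ h : Finset ι → V, h ∅ = 0 ∧
        ∀ T ⊆ s, diff ℓ s h T = f (insert a T) := by
      -- Resetting the value at `∅` does not change the differential, and it makes the chain to be
      -- lifted next vanish at `∅`.
      refine ⟨Function.update (h₁ + e) ∅ 0, by simp, fun T hT => ?_⟩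
      rw [diff_congr (g := h₁ + e) ℓ hT fun U _ hU => Function.update_of_ne hU _ _, map_add,
        Pi.add_apply, hh₁ T hT]
      simp
    -- The part of `f` without `a` becomes a cycle for `s` once the contribution `± ℓ a h` of the
    -- lift `h` is removed.
    obtain ⟨k, k_empty, hk⟩ := ih (f - fun U => (-1 : R) ^ U.card • ℓ a (h U))
      (by simp [hf₀, h_empty])
      (fun T hT => by
        rw [map_sub, Pi.sub_apply, diff_sign, diff_map (hℓ a), hh T hT, sub_neg_eq_add]
        exact hout T hT)
    -- The two lifts are assembled into one chain: `h` on the sets with `a`, `k` on the others.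
    refine ⟨fun T => if a ∈ T then h (T.erase a) else k T, by simpa using k_empty,
      fun T hT => ?_⟩
    have hgin : ∀ U ⊆ s, (if a ∈ insert a U then h ((insert a U).erase a) else
        k (insert a U)) = h U := fun U hU => by
      rw [if_pos (Finset.mem_insert_self a U), Finset.erase_insert (fun h => has (hU h))]
    by_cases haT : a ∈ T
    · obtain ⟨U, haU, rfl⟩ : ∃ U, a ∉ U ∧ insert a U = T :=
        ⟨T.erase a, Finset.notMem_erase a T, Finset.insert_erase haT⟩
      have hU : U ⊆ s := (Finset.insert_subset_insert_iff haU).1 hT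
      rw [diff_insert_apply_insert ℓ ha, ← hh U hU]
      exact diff_congr ℓ hU fun W hW _ => hgin W hW
    · have hT : T ⊆ s := (Finset.subset_insert_iff_of_notMem haT).1 hT
      rw [diff_insert_apply ℓ ha hT, hgin T hT, diff_congr (g := k) ℓ hT
        fun W hW _ => if_neg (fun h => has (hW h)), hk T hT]
      simp

end KoszulEnd

/-! ### The graded complex inside the ungraded one -/

namespace KoszulEnd

open LinFun

variable {R : Type*} [CommRing R] {V : Type*} [AddCommGroup V] [Module R V] {n p : ℕ}

/-- Extension by zero of a function of the sets of cardinality `p` to all finite sets. -/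
def extend (b : KIdx n p → V) (S : Finset (Fin n)) : V := if h : S.card = p then b ⟨S, h⟩ else 0

lemma extend_apply (b : KIdx n p → V) (S : KIdx n p) : extend b S.1 = b S := dif_pos S.2

lemma extend_of_ne (b : KIdx n p → V) {S : Finset (Fin n)} (hS : S.card ≠ p) : extend b S = 0 :=
  dif_neg hS

/-- The graded Koszul differential is the restriction of the ungraded one. -/
lemma sum_single_erase (ℓ : Fin n → Module.End R V) (b : KIdx n (p + 1) → V) (T : KIdx n p) :
    (∑ S : KIdx n (p + 1), ∑ i : S.1,
      (-1 : R) ^ S.pos i • (Pi.single (S.erase i) (ℓ i (b S)) : KIdx n p → V)) T =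
      diff ℓ Finset.univ (extend b) T.1 := by
  have herase : ∀ (S : KIdx n (p + 1)) (i : S.1), S.erase i = T ↔ S.1.erase i = T.1 :=
    fun S i => Subtype.ext_iff
  rw [← Fintype.sum_sigma' (f := fun (S : KIdx n (p + 1)) (i : S.1) =>
    (-1 : R) ^ S.pos i • (Pi.single (S.erase i) (ℓ i (b S)) : KIdx n p → V)), Finset.sum_apply,
    diff_apply]
  simp only [Pi.smul_apply, Pi.single_apply, smul_ite, smul_zero, eq_comm (a := T), herase]
  rw [← Finset.sum_filter]
  -- The pairs `(S, i)` with `S ∖ {i} = T` correspond to the elements `i ∉ T` through `S = T ∪ {i}`.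
  -- The signs agree since removing `i` does not alter the elements below `i`.
  refine Finset.sum_bij (fun σ _ => σ.2.1) ?_ ?_ ?_ ?_
  · rintro ⟨S, i⟩ hσ
    rw [← (Finset.mem_filter.1 hσ).2]
    simp
  · rintro ⟨⟨S, hS⟩, ⟨i, hi⟩⟩ hσ ⟨⟨S', hS'⟩, ⟨i', hi'⟩⟩ hσ' (rfl : i = i')
    have h := (Finset.mem_filter.1 hσ).2.trans (Finset.mem_filter.1 hσ').2.symm
    have : S = S' := by
      exact (Finset.insert_erase hi).symm.trans
        ((congrArg (insert i) h).trans (Finset.insert_erase hi'))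
    subst this
    rfl
  · intro i hi
    have hi : i ∉ T.1 := (Finset.mem_sdiff.1 hi).2
    exact ⟨⟨⟨insert i T.1, by rw [Finset.card_insert_of_notMem hi, T.2]⟩,
      ⟨i, Finset.mem_insert_self i T.1⟩⟩, by simp [Finset.erase_insert hi], rfl⟩
  · rintro ⟨S, i⟩ hσ
    have h : S.1.erase i = T.1 := (Finset.mem_filter.1 hσ).2
    change (-1 : R) ^ (S.1.filter (· < i.1)).card • ℓ i (b S) = _
    rw [← h, Finset.insert_erase i.2, extend_apply, Finset.filter_erase,
      Finset.erase_eq_of_notMem (by simp)]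

lemma diff_extend_of_ne (ℓ : Fin n → Module.End R V) (b : KIdx n (p + 1) → V)
    {T : Finset (Fin n)} (hT : T.card ≠ p) : diff ℓ Finset.univ (extend b) T = 0 := by
  rw [diff_apply]
  refine Finset.sum_eq_zero fun i hi => ?_
  rw [extend_of_ne, map_zero, smul_zero]
  rw [Finset.card_insert_of_notMem (Finset.mem_sdiff.1 hi).2]
  omega

lemma extend_diff_extend (ℓ : Fin n → Module.End R V) (b : KIdx n (p + 1) → V) :
    extend (fun T : KIdx n p => diff ℓ Finset.univ (extend b) T.1) =
      diff ℓ Finset.univ (extend b) := by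
  funext T
  by_cases hT : T.card = p
  · exact extend_apply _ ⟨T, hT⟩
  · rw [extend_of_ne _ hT, diff_extend_of_ne ℓ b hT]

/-- The differential at a set of size `p` sees only sets of size `p + 1`. A lift found among
ungraded chains can therefore be cut down to its homogeneous part. -/
lemma diff_extend_restrict (ℓ : Fin n → Module.End R V) (g : Finset (Fin n) → V) (T : KIdx n p) :
    diff ℓ Finset.univ (extend fun S : KIdx n (p + 1) => g S.1) T.1 =
      diff ℓ Finset.univ g T.1 := by
  rw [diff_apply, diff_apply]
  refine Finset.sum_congr rfl fun i hi => ?_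
  have h : (insert i T.1).card = p + 1 := by
    rw [Finset.card_insert_of_notMem (Finset.mem_sdiff.1 hi).2, T.2]
  rw [extend_apply _ ⟨_, h⟩]

/-- Exactness of the graded Koszul complex in positive degrees. -/
lemma exact_graded {ℓ : Fin n → Module.End R V} (hℓ : ∀ i j, Commute (ℓ i) (ℓ j))
    (hreg : ∀ i, ∀ v, ℓ i v ∈ LinearMap.range (total ℓ (Finset.univ.filter (· < i))) →
      v ∈ LinearMap.range (total ℓ (Finset.univ.filter (· < i)))) (b : KIdx n (p + 1) → V) :
    (∀ T : KIdx n p, diff ℓ Finset.univ (extend b) T.1 = 0) ↔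
      ∃ c : KIdx n (p + 2) → V, ∀ S : KIdx n (p + 1),
        diff ℓ Finset.univ (extend c) S.1 = b S := by
  constructor
  · intro hb
    obtain ⟨g, -, hg⟩ := exists_diff_eq hℓ Finset.univ (fun i _ => hreg i) (extend b)
      -- The chain `b` has positive degree `p + 1`, so its extension vanishes at `∅`.
      (extend_of_ne b (by simp)) (fun T _ => by
        by_cases hT : T.card = p
        · exact hb ⟨T, hT⟩
        · exact diff_extend_of_ne ℓ b hT)
    refine ⟨fun S => g S.1, fun S => ?_⟩
    rw [diff_extend_restrict, hg _ (Finset.subset_univ _), extend_apply]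
  · rintro ⟨c, hc⟩ T
    obtain rfl : (fun S : KIdx n (p + 1) => diff ℓ Finset.univ (extend c) S.1) = b := funext hc
    rw [extend_diff_extend, diff_diff hℓ _ _ (Finset.subset_univ _)]

end KoszulEnd

/-! ### Submodules of `A`-modules -/

namespace LinFun

open KoszulEnd

variable {R : Type w} [CommRing R] {X : Type u} [Category.{w} X] [EssentiallySmall.{w} X]
  [Preadditive X] [Linear R X] [MonoidalCategory X] [MonoidalPreadditive X] [MonoidalLinear R X]

lemma SubMod.subset_generated {A : LinFun R X} [MonObj A] (M : Mod (LinFun R X) A) {v : X}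
    (S : Set (M.X.El v)) : S ⊆ (SubMod.generated M S).carrier v := fun _ hm =>
  (Submodule.mem_iInf _).2 fun N => N.2 hm

lemma SubMod.generated_le {A : LinFun R X} [MonObj A] {M : Mod (LinFun R X) A} {v : X}
    {S : Set (M.X.El v)} (N : SubMod M) (h : S ⊆ N.carrier v) (x : X) :
    (SubMod.generated M S).carrier x ≤ N.carrier x :=
  iInf_le (fun N : {N : SubMod M // S ⊆ N.carrier v} => N.1.carrier x) ⟨N, h⟩

lemma SubMod.mkQ_eq_zero {A : LinFun R X} [MonObj A] {M : Mod (LinFun R X) A} (N : SubMod M)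
    {x : X} {m : M.X.El x} : N.mkQ x m = 0 ↔ m ∈ N.carrier x :=
  Submodule.Quotient.mk_eq_zero (N.carrier x)

/-- Lets unitors and braidings be ignored in questions of membership. -/
lemma SubMod.mp_mem_iff {A : LinFun R X} [MonObj A] {M : Mod (LinFun R X) A} (N : SubMod M)
    {x y : X} (e : x ≅ y) {m : M.X.El x} : M.X.mp e.hom m ∈ N.carrier y ↔ m ∈ N.carrier x := by
  refine ⟨fun h => ?_, fun h => N.mp_mem e.hom h⟩
  have h := N.mp_mem e.inv h
  rwa [← mp_comp, Iso.hom_inv_id, mp_id] at h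

/-! ### Multiplication by the commutant and generated submodules -/

variable [SymmetricCategory X] {A : LinFun R X} [MonObj A]

lemma mulLeft_apply (a : commutant A (𝟙_ X)) {x : X} (b : A.El x) :
    mev (mulLeft a) x b = A.mp (λ_ x).hom (mulE a.1 b) := rfl

/-- Since `L_a` is a natural morphism of `A`-modules, it commutes with both steps of `L_b`: the
product with `b` and the transport along `λ_x`. -/
lemma mulLeft_comm (a b : commutant A (𝟙_ X)) {x : X} (c : A.El x) :
    mev (mulLeft a) x (mev (mulLeft b) x c) = mev (mulLeft b) x (mev (mulLeft a) x c) := by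
  rw [mulLeft_apply b c, mulLeft_apply b (mev (mulLeft a) x c)]
  have h₁ := mev_mp (mulLeft a) (λ_ x).hom (mulE b.1 c)
  have h₂ := mev_act (mulLeft a) b.1 (M := regMod A) (N := regMod A) c
  rw [regMod_act, regMod_act] at h₂
  rw [h₂] at h₁
  exact h₁

/-- The unit law gives `1 × a`, not `a × 1`. The commutant condition exchanges the two up to the
braiding of `𝟙` with itself, which is trivial because the two unitors of `𝟙` coincide. -/
lemma mulLeft_one (a : commutant A (𝟙_ X)) : mev (mulLeft a) (𝟙_ X) (oneE A) = a.1 := by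
  have h := a.2 (𝟙_ X) (oneE A)
  rw [← regMod_act, one_act] at h
  have h' := congrArg (A.mp (λ_ (𝟙_ X)).hom) h
  rw [← mp_comp, ← mp_comp, Iso.inv_hom_id, mp_id, braiding_tensorUnit_left] at h'
  rw [mulLeft_apply]
  refine Eq.trans (mp_congr A ?_ _) h'.symm
  simp [unitors_equal]

/-- The endomorphisms of `A(x)` given by multiplication by the `α_i`. -/
noncomputable def mulEnd {n : ℕ} (α : Fin n → commutant A (𝟙_ X)) (x : X) (i : Fin n) :
    Module.End R (A.El x) := mev (mulLeft (α i)) x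

lemma mulEnd_commute {n : ℕ} (α : Fin n → commutant A (𝟙_ X)) (x : X) (i j : Fin n) :
    Commute (mulEnd α x i) (mulEnd α x j) :=
  LinearMap.ext fun c => mulLeft_comm (α i) (α j) c

/-- The sums of multiples of the `α_i` with `i ∈ s` form a submodule of `A`. -/
noncomputable def totalSub {n : ℕ} (α : Fin n → commutant A (𝟙_ X)) (s : Finset (Fin n)) :
    SubMod (regMod A) where
  carrier x := LinearMap.range (total (mulEnd α x) s)
  mp_mem {x y} f m hm := by
    obtain ⟨c, rfl⟩ := hm
    refine ⟨fun j => A.mp f (c j), ?_⟩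
    rw [total_apply, total_apply]
    exact (Finset.sum_congr rfl fun j _ => mev_mp (mulLeft (α j)) f (c j)).trans
      (map_sum (A.mp f) _ _).symm
  act_mem {y z} a m hm := by
    obtain ⟨c, rfl⟩ := hm
    refine ⟨fun j => act (M := regMod A) a (c j), ?_⟩
    rw [total_apply, total_apply]
    exact (Finset.sum_congr rfl fun j _ => mev_act (mulLeft (α j)) a (c j)).trans
      (map_sum (actLin (M := regMod A) a z) _ _).symm

/-- The sums of multiples form a submodule containing each `α_i = L_{α_i}(1)`, so it contains the
generated one. Conversely, the commutant condition turns `α_i × c` into `c × α_i` up to a braiding,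
and the latter lies in every submodule containing `α_i`. -/
lemma spanSub_carrier {n : ℕ} (α : Fin n → commutant A (𝟙_ X)) (s : Finset (Fin n)) (x : X) :
    (spanSub α s).carrier x = LinearMap.range (total (mulEnd α x) s) := by
  refine le_antisymm (SubMod.generated_le (totalSub α s) ?_ x) ?_
  · rintro _ ⟨i, hi, rfl⟩
    have h := apply_mem_range_total (mulEnd α (𝟙_ X)) (Finset.mem_coe.1 hi) (oneE A)
    rw [mulEnd, mulLeft_one] at h
    exact h
  · rintro _ ⟨c, rfl⟩
    rw [total_apply]
    refine Submodule.sum_mem _ fun i hi => (spanSub α s).mp_mem (λ_ x).hom ?_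
    have h := (spanSub α s).act_mem (c i)
      (SubMod.subset_generated (regMod A) (v := 𝟙_ X) _ ⟨i, Finset.mem_coe.2 hi, rfl⟩)
    rw [regMod_act, (α i).2 x (c i)] at h
    exact ((spanSub α s).mp_mem_iff (β_ (𝟙_ X) x)).1 h

lemma IsRegularSeq.mem_range {n : ℕ} {α : Fin n → commutant A (𝟙_ X)} (hα : IsRegularSeq α)
    (x : X) (i : Fin n) (v : A.El x)
    (hv : mulEnd α x i v ∈ LinearMap.range (total (mulEnd α x) (Finset.univ.filter (· < i)))) :
    v ∈ LinearMap.range (total (mulEnd α x) (Finset.univ.filter (· < i))) := by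
  have hs : {j | j < i} = ((Finset.univ.filter (· < i) : Finset (Fin n)) : Set (Fin n)) := by
    ext j; simp
  have hreg := hα.regular i
  rw [hs] at hreg
  rw [← spanSub_carrier] at hv ⊢
  by_contra hne
  refine hreg x (SubMod.mkQ _ x v) (fun h => hne ((SubMod.mkQ_eq_zero _).1 h)) ?_
  -- The product of `α_i` with the class of `v` is the class of `α_i × v`, which differs from `ℓ i
  -- v` only by the isomorphism `λ_x`.
  refine (mev_act (SubMod.proj _) (α i).1 (M := regMod A) v).symm.trans ?_
  exact (SubMod.mkQ_eq_zero _).2 ((SubMod.mp_mem_iff _ (λ_ x)).1 hv)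

/-! ### The Koszul differentials at an object -/

lemma koszulD_apply {n : ℕ} (α : Fin n → commutant A (𝟙_ X)) (p : ℕ) (x : X)
    (b : KIdx n (p + 1) → A.El x) :
    mev (koszulD α p) x b =
      fun T : KIdx n p => diff (mulEnd α x) Finset.univ (extend b) T.1 := by
  funext T
  rw [← sum_single_erase]
  have h : ∀ c : (koszul A n (p + 1)).X.El x, koszulDEl α p x c =
      ∑ S : KIdx n (p + 1), ∑ i : S.1, (-1 : R) ^ S.pos i •
        mev (powProj (regMod A) S ≫ mulLeft (α i) ≫ powIncl (regMod A) (S.erase i)) x c := by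
    intro c
    simp only [koszulDEl, LinearMap.sum_apply, LinearMap.smul_apply]
  exact congrFun (h b) T

lemma koszulL_apply {n : ℕ} (α : Fin n → commutant A (𝟙_ X)) (x : X)
    (b : KIdx n 1 → A.El x) :
    mev (koszulL α) x b = total (mulEnd α x) Finset.univ fun i => extend b {i} := by
  rw [← diff_empty]
  exact congrFun (koszulD_apply α 0 x b) ⟨∅, Finset.card_empty⟩

end LinFun

theorem theorem3p3 {R : Type w} [CommRing R] {X : Type u} [Category.{w} X]
    [EssentiallySmall.{w} X] [Preadditive X] [Linear R X] [MonoidalCategory X]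
    [MonoidalPreadditive X] [MonoidalLinear R X] [SymmetricCategory X]
    (A : LinFun R X) [MonObj A] {n : ℕ} (α : Fin n → LinFun.commutant A (𝟙_ X))
    (hα : LinFun.IsRegularSeq α) :
    (∀ p : ℕ, p + 1 = n → ∀ x : X, Function.Injective (LinFun.mev (LinFun.koszulD α p) x)) ∧
    (∀ p : ℕ, LinFun.ModExact (LinFun.koszulD α (p + 1)) (LinFun.koszulD α p)) ∧
    LinFun.ModExact (LinFun.koszulL α) (LinFun.spanSub α Set.univ).proj ∧
    (∀ x : X, Function.Surjective (LinFun.mev (LinFun.spanSub α Set.univ).proj x)) := by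
  have hexact : ∀ p : ℕ, LinFun.ModExact (LinFun.koszulD α (p + 1)) (LinFun.koszulD α p) := by
    intro p x (b : LinFun.KIdx n (p + 1) → A.El x)
    have h := KoszulEnd.exact_graded (LinFun.mulEnd_commute α x) (hα.mem_range x) b
    refine Iff.trans ?_ (h.trans ?_)
    · rw [LinFun.koszulD_apply]
      exact funext_iff
    · refine exists_congr fun c => Iff.trans ?_ (Eq.congr_left (LinFun.koszulD_apply α _ x c).symm)
      exact funext_iff.symm
  refine ⟨fun p hp x => ?_, hexact, fun x b => ?_, fun x => LinFun.SubMod.mkQ_surjective _ x⟩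
  · rw [injective_iff_map_eq_zero]
    intro b hb
    obtain ⟨c, rfl⟩ := (hexact p x b).1 hb
    -- Here `c` is indexed by subsets of `Fin n` with `p + 2 = n + 1` elements, and there are none.
    have hc : c = 0 := funext fun S => absurd (S.1.card_le_univ) (by simp [S.2]; omega)
    rw [hc, map_zero]
  · have hu := LinFun.spanSub_carrier α Finset.univ x
    rw [Finset.coe_univ] at hu
    refine (LinFun.SubMod.mkQ_eq_zero _).trans ?_
    rw [hu]
    constructor
    · rintro ⟨c, rfl⟩
      -- Summing over the one-element set `S` is a choice-free way to read off `c i` at `S = {i}`.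
      refine ⟨fun S : LinFun.KIdx n 1 => ∑ i ∈ S.1, c i, ?_⟩
      refine (LinFun.koszulL_apply α x _).trans (congrArg _ (funext fun i => ?_))
      exact (KoszulEnd.extend_apply (fun S : LinFun.KIdx n 1 => ∑ i ∈ S.1, c i)
        ⟨{i}, Finset.card_singleton i⟩).trans (by simp)
    · rintro ⟨c, rfl⟩
      exact ⟨_, (LinFun.koszulL_apply α x c).symm⟩
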